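/- Let $G$ be a compact Lie group, let $\pi\colon P\to M$ be a smooth principal $G$-bundle over a (Hausdorff, paracompact, finite-dimensional) smooth manifold $M$ without boundary ("spacetime"), and let $\rho\colon G\to \mathrm{Aut}(\mathbb K^N)$, $\mathbb K\in\{\mathbb R,\mathbb C\}$, be a smooth faithful orthogonal (resp. unitary) representation. Let $V\colon\mathbb K^N\to\mathbb R$ be a general Higgs potential, i.e. a smooth, $G$-invariant function that is bounded below and whose Hessian is positive definite transversally to every orbit of minima, and fix a minimum $z_0$ of $V$. The Higgs bundle is $E=P\times_\rho\mathbb K^N$. A *vacuum section* (with respect to $z_0$) is a smooth section $\mathcal V$ of $E$ with values in the orbit bundle $P\times_\rho\mathrm{orbit}(z_0)\subset E$; it determines the reduction $Q_{\mathcal V}=\{p\in P : \mathcal V(\pi(p))=[(p,z_0)]\}$ of $P$ to the isotropy group of $z_0$. A connection on $P$ is *compatible* with $\mathcal V$ if it restricts to a connection on $Q_{\mathcal V}$, i.e. if its horizontal spaces at points of $Q_{\mathcal V}$ are tangent to $Q_{\mathcal V}$. A *vacuum pair* on $P$ (with respect to $z_0$) is a pair $(A,\mathcal V)$ of a flat connection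 $A$ on $P$ (i.e. with vanishing curvature) and a vacuum section $\mathcal V$ with which $A$ is compatible. Two such pairs, on principal $G$-bundles $P$ and $P'$ over $M$, are *equivalent* if some isomorphism $P\to P'$ of principal $G$-bundles over $\mathrm{id}_M$ carries one pair to the other; for $P=P'$ such isomorphisms are the gauge transformations, and equivalent pairs are called *gauge equivalent*. Suppose that $M$ is simply connected. Then: 1. Any two vacuum pairs on $P$ with respect to $z_0$ are gauge equivalent. 2. Every vacuum pair on $P$ with respect to $z_0$ is equivalent to the canonical pair $(\mathrm d,z_0)$ on the trivial bundle $M\times G\to M$, where $\mathrm d$ is the canonical flat connection (the pull-back of the Maurer–Cartan form of $G$) and $z_0$ denotes the section $x\mapsto[((x,1),z_0)]$. In particular, if a vacuum pair exists then $P$ is trivial. -/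

import Mathlib

open scoped Manifold ContDiff
open MulOpposite

noncomputable section

namespace YangMillsHiggs

/-! ### Principal bundles -/

section Principal

variable {EM HM EG HG EP HP EP' HP' M G P P' : Type*}
  [NormedAddCommGroup EM] [NormedSpace ℝ EM] [TopologicalSpace HM]
  [NormedAddCommGroup EG] [NormedSpace ℝ EG] [TopologicalSpace HG]
  [NormedAddCommGroup EP] [NormedSpace ℝ EP] [TopologicalSpace HP]
  [NormedAddCommGroup EP'] [NormedSpace ℝ EP'] [TopologicalSpace HP']
  [TopologicalSpace M] [ChartedSpace HM M]
  [TopologicalSpace G] [ChartedSpace HG G] [Group G]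
  [TopologicalSpace P] [ChartedSpace HP P] [MulAction Gᵐᵒᵖ P]
  [TopologicalSpace P'] [ChartedSpace HP' P'] [MulAction Gᵐᵒᵖ P']

/-- `π : P → M` is a smooth principal `G`-bundle. The right action `p · g` of `G` on `P` is written
`op g • p`. Around every point of the base there is a smooth, `G`-equivariant local
trivialization; smoothness of `π` and of the action, and the fact that `G` acts simply
transitively on the fibres, are consequences. -/
structure IsPrincipalBundle (IM : ModelWithCorners ℝ EM HM) (IG : ModelWithCorners ℝ EG HG)
    (IP : ModelWithCorners ℝ EP HP) (π : P → M) : Prop where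
  proj_act : ∀ (g : G) (p : P), π (op g • p) = π p
  locally_trivial : ∀ x : M, ∃ e : Bundle.Trivialization G π, x ∈ e.baseSet ∧
    ContMDiffOn IP (IM.prod IG) ∞ e e.source ∧
    ContMDiffOn (IM.prod IG) IP ∞ e.toOpenPartialHomeomorph.symm e.target ∧
    ∀ p ∈ e.source, ∀ g : G, (e (op g • p)).2 = (e p).2 * g

/-- An isomorphism of principal `G`-bundles over the identity of the base: an equivariant
diffeomorphism of the total spaces which covers the identity. For `P' = P` these are the elements
of the gauge group. -/
structure PrincipalBundleIso (G : Type*) [Group G] [MulAction Gᵐᵒᵖ P] [MulAction Gᵐᵒᵖ P']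
    (IP : ModelWithCorners ℝ EP HP) (IP' : ModelWithCorners ℝ EP' HP')
    (π : P → M) (π' : P' → M) extends Diffeomorph IP IP' P P' ∞ where
  proj_map : ∀ p : P, π' (toEquiv p) = π p
  map_act : ∀ (g : G) (p : P), toEquiv (op g • p) = op g • toEquiv p

/-! ### Connections -/

variable (G) in
/-- The fundamental vector field of `ξ ∈ Lie(G)` at `p`, that is, the velocity at `1` of the orbit
map `g ↦ p · g` in direction `ξ`. -/
def fundamentalVector (IG : ModelWithCorners ℝ EG HG) (IP : ModelWithCorners ℝ EP HP)
    (ξ : GroupLieAlgebra IG G) (p : P) : TangentSpace IP p :=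
  (mfderiv IG IP (fun g : G => op g • p) 1 ξ : EP)

/-- The adjoint action `Ad g` of `G` on its Lie algebra. -/
def adjointAction (IG : ModelWithCorners ℝ EG HG) (g : G) (ξ : GroupLieAlgebra IG G) :
    GroupLieAlgebra IG G :=
  (mfderiv IG IG (fun h : G => g * h * g⁻¹) 1 ξ : EG)

/-- `A` is the connection form of a (principal) connection on the principal bundle `P`: a smooth
`Lie(G)`-valued one-form which reproduces the generators of the fundamental vector fields and
satisfies `R_g^* A = Ad(g⁻¹) A`. Smoothness of the one-form is expressed as smoothness of the
corresponding map on the tangent bundle. -/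
structure IsConnection (IG : ModelWithCorners ℝ EG HG) (IP : ModelWithCorners ℝ EP HP)
    [IsManifold IP ∞ P]
    (A : ∀ p : P, TangentSpace IP p →L[ℝ] GroupLieAlgebra IG G) : Prop where
  smooth : ContMDiff (M' := EG) IP.tangent 𝓘(ℝ, EG) ∞
    (fun v : TangentBundle IP P => (A v.1 v.2 : EG))
  fundamental : ∀ (p : P) (ξ : GroupLieAlgebra IG G), A p (fundamentalVector G IG IP ξ p) = ξ
  equivariant : ∀ (g : G) (p : P) (u : TangentSpace IP p),
    A (op g • p) (mfderiv IP IP (fun q : P => op g • q) p u) = adjointAction IG g⁻¹ (A p u)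

/-- The connection with connection form `A` is flat: its curvature form
`Ω(X, Y) = dA(X^hor, Y^hor) = -A([X^hor, Y^hor])` vanishes, that is, the Lie bracket of any two
(locally defined) smooth horizontal vector fields is horizontal. -/
def IsFlat (IG : ModelWithCorners ℝ EG HG) (IP : ModelWithCorners ℝ EP HP) [IsManifold IP ∞ P]
    (A : ∀ p : P, TangentSpace IP p →L[ℝ] GroupLieAlgebra IG G) : Prop :=
  ∀ (U : Set P) (X Y : ∀ p : P, TangentSpace IP p), IsOpen U →
    ContMDiffOn IP IP.tangent ∞ (fun p => (⟨p, X p⟩ : TangentBundle IP P)) U →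
    ContMDiffOn IP IP.tangent ∞ (fun p => (⟨p, Y p⟩ : TangentBundle IP P)) U →
    (∀ p ∈ U, A p (X p) = 0) → (∀ p ∈ U, A p (Y p) = 0) →
    ∀ p ∈ U, A p (VectorField.mlieBracket IP X Y p) = 0

/-- The vectors at `p` which are tangent to the subset `Q`: the velocities at `p` of smooth curves
in `P` that run inside `Q`. For an embedded submanifold this is its tangent space at `p`. -/
def tangentVectors (IP : ModelWithCorners ℝ EP HP) (Q : Set P) (p : P) :
    Set (TangentSpace IP p) :=
  {u | ∃ γ : ℝ → P, ContMDiff 𝓘(ℝ, ℝ) IP ∞ γ ∧ (∀ t, γ t ∈ Q) ∧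
    (⟨γ 0, mfderiv 𝓘(ℝ, ℝ) IP γ 0 (1 : ℝ)⟩ : TangentBundle IP P) = ⟨p, u⟩}

/-- The connection `A` on `P` restricts to a connection on the subbundle `Q ⊆ P`: along `Q` its
horizontal spaces are tangent to `Q`. -/
def RestrictsTo (IG : ModelWithCorners ℝ EG HG) (IP : ModelWithCorners ℝ EP HP)
    (A : ∀ p : P, TangentSpace IP p →L[ℝ] GroupLieAlgebra IG G) (Q : Set P) : Prop :=
  ∀ p ∈ Q, ∀ u : TangentSpace IP p, A p u = 0 → u ∈ tangentVectors IP Q p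

end Principal

/-! ### Higgs potentials -/

section Potential

variable {EG HG G : Type*} [NormedAddCommGroup EG] [NormedSpace ℝ EG] [TopologicalSpace HG]
  [TopologicalSpace G] [ChartedSpace HG G] [Group G]
  {𝕜 : Type*} [RCLike 𝕜] {N : ℕ}

/-- `ρ` is a smooth faithful representation (it is unitary, resp. orthogonal, by its type). -/
structure IsHiggsRepresentation (IG : ModelWithCorners ℝ EG HG)
    (ρ : G →* (EuclideanSpace 𝕜 (Fin N) ≃ₗᵢ[𝕜] EuclideanSpace 𝕜 (Fin N))) : Prop where
  smooth : ContMDiff (IG.prod 𝓘(ℝ, EuclideanSpace 𝕜 (Fin N))) 𝓘(ℝ, EuclideanSpace 𝕜 (Fin N)) ∞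
    (fun a : G × EuclideanSpace 𝕜 (Fin N) => ρ a.1 a.2)
  faithful : Function.Injective ρ

/-- `z` is a minimum of `V`. -/
def IsMinimum (V : EuclideanSpace 𝕜 (Fin N) → ℝ) (z : EuclideanSpace 𝕜 (Fin N)) : Prop :=
  ∀ w, V z ≤ V w

/-- The tangent space at `z` of the orbit of `z`: the vectors `ρ'(ξ) z` with `ξ ∈ Lie(G)`. -/
def orbitTangent (IG : ModelWithCorners ℝ EG HG)
    (ρ : G →* (EuclideanSpace 𝕜 (Fin N) ≃ₗᵢ[𝕜] EuclideanSpace 𝕜 (Fin N)))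
    (z : EuclideanSpace 𝕜 (Fin N)) : Set (EuclideanSpace 𝕜 (Fin N)) :=
  {v | ∃ ξ : GroupLieAlgebra IG G,
    v = mfderiv IG 𝓘(ℝ, EuclideanSpace 𝕜 (Fin N)) (fun g : G => ρ g z) 1 ξ}

/-- A general Higgs potential: a smooth real function, bounded below and invariant, whose Hessian
is positive definite transversally to every orbit of minima. -/
structure IsGeneralHiggsPotential (IG : ModelWithCorners ℝ EG HG)
    (ρ : G →* (EuclideanSpace 𝕜 (Fin N) ≃ₗᵢ[𝕜] EuclideanSpace 𝕜 (Fin N)))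
    (V : EuclideanSpace 𝕜 (Fin N) → ℝ) : Prop where
  smooth : ContDiff ℝ ∞ V
  bddBelow : BddBelow (Set.range V)
  invariant : ∀ (g : G) (w : EuclideanSpace 𝕜 (Fin N)), V (ρ g w) = V w
  hessian_pos : ∀ z, IsMinimum V z → ∀ w, w ≠ 0 →
    (∀ v ∈ orbitTangent IG ρ z, RCLike.re (inner 𝕜 v w) = 0) →
    0 < fderiv ℝ (fderiv ℝ V) z w w

end Potential

/-! ### The Higgs bundle, its sections, and vacuum pairs -/

section Higgs

variable {EM HM EG HG EP HP EP' HP' M G P P' : Type*}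
  [NormedAddCommGroup EM] [NormedSpace ℝ EM] [TopologicalSpace HM]
  [NormedAddCommGroup EG] [NormedSpace ℝ EG] [TopologicalSpace HG]
  [NormedAddCommGroup EP] [NormedSpace ℝ EP] [TopologicalSpace HP]
  [NormedAddCommGroup EP'] [NormedSpace ℝ EP'] [TopologicalSpace HP']
  [TopologicalSpace M] [ChartedSpace HM M]
  [TopologicalSpace G] [ChartedSpace HG G] [Group G]
  [TopologicalSpace P] [ChartedSpace HP P] [MulAction Gᵐᵒᵖ P]
  [TopologicalSpace P'] [ChartedSpace HP' P'] [MulAction Gᵐᵒᵖ P']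
  {𝕜 : Type*} [RCLike 𝕜] {N : ℕ}

/-- The equivalence relation `(p, w) ∼ (p · g, ρ(g)⁻¹ w)` on `P × 𝕜^N`. -/
def higgsSetoid (P : Type*) [MulAction Gᵐᵒᵖ P]
    (ρ : G →* (EuclideanSpace 𝕜 (Fin N) ≃ₗᵢ[𝕜] EuclideanSpace 𝕜 (Fin N))) :
    Setoid (P × EuclideanSpace 𝕜 (Fin N)) where
  r a b := ∃ g : G, b = (op g • a.1, ρ g⁻¹ a.2)
  iseqv :=
    { refl := fun a => ⟨1, by simp⟩
      symm := by
        rintro a b ⟨g, rfl⟩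
        refine ⟨g⁻¹, Prod.ext ?_ ?_⟩
        · simp
        · change a.2 = (ρ g⁻¹⁻¹ * ρ g⁻¹) a.2
          rw [← map_mul]
          simp
      trans := by
        rintro a b c ⟨g, rfl⟩ ⟨h, rfl⟩
        refine ⟨g * h, Prod.ext ?_ ?_⟩
        · simp [mul_smul]
        · change (ρ h⁻¹ * ρ g⁻¹) a.2 = ρ (g * h)⁻¹ a.2
          rw [← map_mul, mul_inv_rev] }

/-- The total space `P ×_ρ 𝕜^N` of the Higgs bundle. -/
def HiggsBundle (P : Type*) [MulAction Gᵐᵒᵖ P]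
    (ρ : G →* (EuclideanSpace 𝕜 (Fin N) ≃ₗᵢ[𝕜] EuclideanSpace 𝕜 (Fin N))) : Type _ :=
  Quotient (higgsSetoid P ρ)

/-- The class `[(p, w)]` in the Higgs bundle. -/
def HiggsBundle.mk (ρ : G →* (EuclideanSpace 𝕜 (Fin N) ≃ₗᵢ[𝕜] EuclideanSpace 𝕜 (Fin N)))
    (p : P) (w : EuclideanSpace 𝕜 (Fin N)) : HiggsBundle P ρ :=
  Quotient.mk (higgsSetoid P ρ) (p, w)

/-- The map `[(p, w)] ↦ [(f(p), w)]` of Higgs bundles induced by an isomorphism `f` of principal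
bundles. -/
def HiggsBundle.map {IP : ModelWithCorners ℝ EP HP} {IP' : ModelWithCorners ℝ EP' HP'}
    {π : P → M} {π' : P' → M}
    (ρ : G →* (EuclideanSpace 𝕜 (Fin N) ≃ₗᵢ[𝕜] EuclideanSpace 𝕜 (Fin N)))
    (f : PrincipalBundleIso G IP IP' π π') : HiggsBundle P ρ → HiggsBundle P' ρ :=
  Quotient.map (fun a => (f.toEquiv a.1, a.2)) (by
    rintro a b ⟨g, rfl⟩
    exact ⟨g, Prod.ext (f.map_act g a.1) rfl⟩)

/-- `Φ` is a smooth section of the Higgs bundle: it is of the form `Φ(π(p)) = [(p, φ(p))]` for a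
smooth `ρ`-equivariant map `φ : P → 𝕜^N`. -/
def IsHiggsSection (IP : ModelWithCorners ℝ EP HP) (π : P → M)
    (ρ : G →* (EuclideanSpace 𝕜 (Fin N) ≃ₗᵢ[𝕜] EuclideanSpace 𝕜 (Fin N)))
    (Φ : M → HiggsBundle P ρ) : Prop :=
  ∃ φ : P → EuclideanSpace 𝕜 (Fin N), ContMDiff IP 𝓘(ℝ, EuclideanSpace 𝕜 (Fin N)) ∞ φ ∧
    (∀ (g : G) (p : P), φ (op g • p) = ρ g⁻¹ (φ p)) ∧
    ∀ p : P, Φ (π p) = HiggsBundle.mk ρ p (φ p)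

variable (P) in
/-- The orbit bundle `P ×_ρ orbit(z₀)`, as a subset of the Higgs bundle. -/
def orbitBundle (ρ : G →* (EuclideanSpace 𝕜 (Fin N) ≃ₗᵢ[𝕜] EuclideanSpace 𝕜 (Fin N)))
    (z₀ : EuclideanSpace 𝕜 (Fin N)) : Set (HiggsBundle P ρ) :=
  {e | ∃ (p : P) (g : G), e = HiggsBundle.mk ρ p (ρ g z₀)}

/-- A vacuum section with respect to `z₀`: a smooth section of the orbit bundle of `z₀`. -/
def IsVacuumSection (IP : ModelWithCorners ℝ EP HP) (π : P → M)
    (ρ : G →* (EuclideanSpace 𝕜 (Fin N) ≃ₗᵢ[𝕜] EuclideanSpace 𝕜 (Fin N)))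
    (z₀ : EuclideanSpace 𝕜 (Fin N)) (Φ : M → HiggsBundle P ρ) : Prop :=
  IsHiggsSection IP π ρ Φ ∧ ∀ x, Φ x ∈ orbitBundle P ρ z₀

/-- The vacuum `Q ⊆ P` determined by a vacuum section `Φ`: the reduction of `P` to the isotropy
group of `z₀` that consists of the points `p` with `Φ(π(p)) = [(p, z₀)]`. -/
def vacuumReduction (π : P → M)
    (ρ : G →* (EuclideanSpace 𝕜 (Fin N) ≃ₗᵢ[𝕜] EuclideanSpace 𝕜 (Fin N)))
    (z₀ : EuclideanSpace 𝕜 (Fin N)) (Φ : M → HiggsBundle P ρ) : Set P :=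
  {p | Φ (π p) = HiggsBundle.mk ρ p z₀}

/-- A vacuum pair `(A, Φ)` with respect to `z₀`: a vacuum section `Φ` together with a flat
connection on `P` that is compatible with `Φ`, i.e. restricts to a connection on the vacuum
determined by `Φ`. The connection on the Higgs bundle is the one induced by `A`. -/
structure IsVacuumPair (IG : ModelWithCorners ℝ EG HG) (IP : ModelWithCorners ℝ EP HP)
    [IsManifold IP ∞ P] (π : P → M)
    (ρ : G →* (EuclideanSpace 𝕜 (Fin N) ≃ₗᵢ[𝕜] EuclideanSpace 𝕜 (Fin N)))
    (z₀ : EuclideanSpace 𝕜 (Fin N))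
    (A : ∀ p : P, TangentSpace IP p →L[ℝ] GroupLieAlgebra IG G)
    (Φ : M → HiggsBundle P ρ) : Prop where
  vacuumSection : IsVacuumSection IP π ρ z₀ Φ
  connection : IsConnection IG IP A
  flat : IsFlat IG IP A
  compatible : RestrictsTo IG IP A (vacuumReduction π ρ z₀ Φ)

/-- The pairs `(A, Φ)` on `P` and `(A', Φ')` on `P'` correspond to each other under an isomorphism
`f` of principal bundles over the identity: `f^* A' = A` and `f_* Φ = Φ'`. For `P' = P` this is
gauge equivalence. -/
def PairsEquivalent (IG : ModelWithCorners ℝ EG HG)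
    (IP : ModelWithCorners ℝ EP HP) (IP' : ModelWithCorners ℝ EP' HP')
    (π : P → M) (π' : P' → M)
    (ρ : G →* (EuclideanSpace 𝕜 (Fin N) ≃ₗᵢ[𝕜] EuclideanSpace 𝕜 (Fin N)))
    (A : ∀ p : P, TangentSpace IP p →L[ℝ] GroupLieAlgebra IG G) (Φ : M → HiggsBundle P ρ)
    (A' : ∀ p : P', TangentSpace IP' p →L[ℝ] GroupLieAlgebra IG G)
    (Φ' : M → HiggsBundle P' ρ) : Prop :=
  ∃ f : PrincipalBundleIso G IP IP' π π',
    (∀ (p : P) (u : TangentSpace IP p),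
      A' (f.toEquiv p) (mfderiv IP IP' f.toEquiv p u) = A p u) ∧
    ∀ x, HiggsBundle.map ρ f (Φ x) = Φ' x

end Higgs

/-! ### The trivial bundle and the canonical pair -/

section Trivial

variable {EM HM EG HG M G : Type*}
  [NormedAddCommGroup EM] [NormedSpace ℝ EM] [TopologicalSpace HM]
  [NormedAddCommGroup EG] [NormedSpace ℝ EG] [TopologicalSpace HG]
  [TopologicalSpace M] [ChartedSpace HM M]
  [TopologicalSpace G] [ChartedSpace HG G] [Group G]
  {𝕜 : Type*} [RCLike 𝕜] {N : ℕ}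

/-- The total space `M × G` of the trivial principal bundle (with its product structures). -/
def TrivialBundle (M G : Type*) : Type _ := M × G

instance : TopologicalSpace (TrivialBundle M G) := inferInstanceAs (TopologicalSpace (M × G))

instance : ChartedSpace (ModelProd HM HG) (TrivialBundle M G) :=
  inferInstanceAs (ChartedSpace (ModelProd HM HG) (M × G))

instance : MulAction Gᵐᵒᵖ (TrivialBundle M G) where
  smul g a := (a.1, a.2 * g.unop)
  one_smul a := Prod.ext rfl (mul_one a.2)
  mul_smul g h a := Prod.ext rfl (mul_assoc a.2 h.unop g.unop).symm

/-- The projection `M × G → M`. -/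
def TrivialBundle.proj (a : TrivialBundle M G) : M := a.1

/-- The canonical flat connection `d` on the trivial bundle `M × G`: the pull-back of the
Maurer-Cartan form of `G` under the projection to `G`. -/
def canonicalConnection (M : Type*) [TopologicalSpace M] [ChartedSpace HM M]
    (G : Type*) [TopologicalSpace G] [ChartedSpace HG G] [Group G]
    (IM : ModelWithCorners ℝ EM HM) (IG : ModelWithCorners ℝ EG HG) (a : TrivialBundle M G) :
    TangentSpace (IM.prod IG) a →L[ℝ] GroupLieAlgebra IG G :=
  ((mfderiv IG IG (fun h : G => a.2⁻¹ * h) a.2 : EG →L[ℝ] EG).comp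
    (ContinuousLinearMap.snd ℝ EM EG) : EM × EG →L[ℝ] EG)

/-- The canonical vacuum section `x ↦ (x, z₀)` of the trivial Higgs bundle. -/
def canonicalSection (M : Type*)
    (ρ : G →* (EuclideanSpace 𝕜 (Fin N) ≃ₗᵢ[𝕜] EuclideanSpace 𝕜 (Fin N)))
    (z₀ : EuclideanSpace 𝕜 (Fin N)) (x : M) : HiggsBundle (TrivialBundle M G) ρ :=
  HiggsBundle.mk ρ ((x, 1) : M × G) z₀

end Trivial

end YangMillsHiggs

end

noncomputable section

namespace YangMillsHiggs

/-! ### Total differential equations and the Frobenius theorem -/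

section Frobenius

open Set Metric Filter Topology

variable {E F : Type*} [NormedAddCommGroup E] [NormedSpace ℝ E]
  [NormedAddCommGroup F] [NormedSpace ℝ F]

/-! A flat connection over a simply connected base has a global horizontal section, and such a
section carries all the information of a vacuum pair.

Flatness says that the horizontal distribution is involutive. In a chart of `M`, a chart of `G` and
an equivariant trivialization it is the kernel of a one-form whose vertical part is invertible, so
it is given by a total differential equation `dy = f(x, y)`, and involutivity becomes the symmetry
condition under which this equation is solvable (`exists_integral_graph`,
`exists_hasFDerivAt_of_symmetric`). This gives local horizontal sections
(`exists_isHorizontalSectionOn`).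

By the product rule `IsConnection.apply_mfderiv_act`, two horizontal sections differ by a map to `G`
on which the Maurer-Cartan form vanishes, hence by a locally constant map. The resulting cocycle
defines a covering space of `M`; simple connectedness gives a section of it, which splits the
cocycle and glues the local sections (`exists_splitting_of_locally_constant_cocycle`,
`exists_isHorizontalSectionOn_univ`).

A vacuum section is an equivariant map `φ` on `P`, and compatibility makes `φ` constant in
horizontal directions (`mfderiv_eq_zero_of_restrictsTo`). Along a global horizontal section `s` it
is therefore constant, and a constant translation of `s` makes its value `z₀`. Trivializing `P` by
this `s` turns the connection into the canonical one and the vacuum section into the constant `z₀`.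
Any two vacuum pairs are then compared through the canonical pair. -/

/-- The solution provided by the Picard-Lindelöf theorem stays in the closed ball. -/
theorem exists_mem_closedBall_hasDerivWithinAt [CompleteSpace F] {f : ℝ → F → F}
    {tmin tmax : ℝ} {t₀ : Icc tmin tmax} {y₀ : F} {a L K : NNReal}
    (hf : IsPicardLindelof f t₀ y₀ a 0 L K) :
    ∃ α : ℝ → F, α t₀ = y₀ ∧ (∀ t, α t ∈ closedBall y₀ a) ∧
      ∀ t ∈ Icc tmin tmax, HasDerivWithinAt α (f t (α t)) (Icc tmin tmax) t := by
  obtain ⟨α, hα⟩ := ODE.FunSpace.exists_isFixedPt_next hf (mem_closedBall_self le_rfl)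
  refine ⟨α.compProj, by rw [ODE.FunSpace.compProj_val, ← hα, ODE.FunSpace.next_apply₀],
    fun t => α.compProj_mem_closedBall hf.mul_max_le, fun t ht => ?_⟩
  apply ODE.hasDerivWithinAt_picard_Icc t₀.2 hf.continuousOn_uncurry
    α.continuous_compProj.continuousOn (fun _ ht' ↦ α.compProj_mem_closedBall hf.mul_max_le)
    y₀ ht |>.congr_of_mem _ ht
  intro t' ht'
  nth_rw 1 [← hα]
  rw [ODE.FunSpace.compProj_of_mem ht', ODE.FunSpace.next_apply]

/-- With zero initial distance the Gronwall bound is linear in the error, so an error of order `‖h‖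
^ 2` in a differential equation costs only order `‖h‖ ^ 2` in its solution. -/
theorem gronwallBound_zero_eq_mul (K ε : ℝ) (x : ℝ) :
    gronwallBound 0 K ε x = ε * gronwallBound 0 K 1 x := by
  unfold gronwallBound
  split_ifs <;> ring

/-- Bounds for a `C²` map near a point. -/
theorem exists_closedBall_bounds {X Y : Type*} [NormedAddCommGroup X] [NormedSpace ℝ X]
    [NormedAddCommGroup Y] [NormedSpace ℝ Y] {f : X → Y} {W : Set X} (hW : IsOpen W)
    (hf : ContDiffOn ℝ 2 f W) {z₀ : X} (h0 : z₀ ∈ W) :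
    ∃ r > 0, ∃ C ≥ (1 : ℝ), closedBall z₀ r ⊆ W ∧ (∀ z ∈ closedBall z₀ r, ‖f z‖ ≤ C) ∧
      (∀ z ∈ closedBall z₀ r, ‖fderiv ℝ f z‖ ≤ C) ∧
      ∀ z ∈ closedBall z₀ r, ∀ z' ∈ closedBall z₀ r,
        ‖f z' - f z - fderiv ℝ f z (z' - z)‖ ≤ C * ‖z' - z‖ ^ 2 := by
  have hWn : W ∈ 𝓝 z₀ := hW.mem_nhds h0
  have hd : ContDiffOn ℝ 1 (fderiv ℝ f) W := hf.fderiv_of_isOpen hW (by norm_num)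
  obtain ⟨K, s, hs, hK⟩ := (hd.contDiffAt hWn).exists_lipschitzOnWith
  have c1 : ∀ᶠ z in 𝓝 z₀, ‖f z‖ < ‖f z₀‖ + 1 :=
    (hf.contDiffAt hWn).continuousAt.norm.eventually_lt_const (by linarith)
  have c2 : ∀ᶠ z in 𝓝 z₀, ‖fderiv ℝ f z‖ < ‖fderiv ℝ f z₀‖ + 1 :=
    (hd.contDiffAt hWn).continuousAt.norm.eventually_lt_const (by linarith)
  obtain ⟨r, hr, hrs⟩ := nhds_basis_closedBall.mem_iff.1
    (inter_mem (inter_mem hWn hs) (inter_mem c1 c2))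
  refine ⟨r, hr, 1 + K + ‖f z₀‖ + ‖fderiv ℝ f z₀‖, ?_, fun z hz => (hrs hz).1.1,
    fun z hz => ?_, fun z hz => ?_, fun z hz z' hz' => ?_⟩
  · have : (0 : ℝ) ≤ K := K.2
    linarith [norm_nonneg (f z₀), norm_nonneg (fderiv ℝ f z₀)]
  · have : ‖f z‖ < ‖f z₀‖ + 1 := (hrs hz).2.1
    have : (0 : ℝ) ≤ K := K.2
    linarith [norm_nonneg (fderiv ℝ f z₀)]
  · have : ‖fderiv ℝ f z‖ < ‖fderiv ℝ f z₀‖ + 1 := (hrs hz).2.2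
    have : (0 : ℝ) ≤ K := K.2
    linarith [norm_nonneg (f z₀)]
  · have hseg : segment ℝ z z' ⊆ closedBall z₀ r := (convex_closedBall z₀ r).segment_subset hz hz'
    -- The quadratic remainder bound: on the segment the derivative of `f` deviates from `fderiv ℝ f
    -- z` by at most `K * ‖z' - z‖`, because the derivative is Lipschitz; the mean value inequality
    -- supplies the second factor.
    have key := (convex_segment z z').norm_image_sub_le_of_norm_hasFDerivWithin_le'
      (f := f) (f' := fderiv ℝ f) (φ := fderiv ℝ f z) (C := K * ‖z' - z‖) (x := z) (y := z')
      (fun x hx => ((hf.contDiffAt (hW.mem_nhds (hrs (hseg hx)).1.1)).differentiableAt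
        (by norm_num)).hasFDerivAt.hasFDerivWithinAt)
      (fun x hx => ?_) (left_mem_segment ℝ z z') (right_mem_segment ℝ z z')
    · refine key.trans ?_
      have : 0 ≤ ‖z' - z‖ ^ 2 := by positivity
      have h2 : (K : ℝ) ≤ 1 + K + ‖f z₀‖ + ‖fderiv ℝ f z₀‖ := by
        linarith [norm_nonneg (fderiv ℝ f z₀), norm_nonneg (f z₀)]
      nlinarith
    · have h1 := hK.dist_le_mul x (hrs (hseg hx)).1.2 z (hrs hz).1.2
      rw [dist_eq_norm, dist_eq_norm] at h1
      refine h1.trans ?_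
      gcongr
      obtain ⟨θ, ⟨h0', h1'⟩, rfl⟩ := (segment_eq_image' ℝ z z' ▸ hx)
      simp only [add_sub_cancel_left, norm_smul, Real.norm_eq_abs, abs_of_nonneg h0']
      nlinarith [norm_nonneg (z' - z)]

/-- **Frobenius theorem** for total differential equations `dy(x) = f(x, y(x))`. -/
theorem exists_hasFDerivAt_of_symmetric [CompleteSpace F] {f : E × F → E →L[ℝ] F}
    {W : Set (E × F)} (hW : IsOpen W) (hf : ContDiffOn ℝ 2 f W)
    (hsymm : ∀ z ∈ W, ∀ v w, fderiv ℝ f z (v, f z v) w = fderiv ℝ f z (w, f z w) v)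
    {x₀ : E} {y₀ : F} (h0 : (x₀, y₀) ∈ W) :
    ∃ U : Set E, IsOpen U ∧ x₀ ∈ U ∧ ∃ y : E → F, y x₀ = y₀ ∧
      ∀ x ∈ U, (x, y x) ∈ W ∧ HasFDerivAt y (f (x, y x)) x := by
  obtain ⟨r, hr, C, hC, hrW, hfC, hdC, hT⟩ := exists_closedBall_bounds hW hf h0
  have hC0 : 0 < C := by linarith
  have hmem : ∀ {x : E} {y : F}, ‖x - x₀‖ ≤ r → ‖y - y₀‖ ≤ r → (x, y) ∈ closedBall (x₀, y₀) r := by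
    intro x y hx hy
    rw [mem_closedBall, Prod.dist_eq, dist_eq_norm, dist_eq_norm]
    exact max_le hx hy
  have hfd : ∀ z ∈ closedBall (x₀, y₀) r, HasFDerivAt f (fderiv ℝ f z) z := fun z hz =>
    ((hf.contDiffAt (hW.mem_nhds (hrW hz))).differentiableAt (by norm_num)).hasFDerivAt
  -- With `C * δ = r / 2`, both the speed and the Lipschitz constant of the equation along a ray are
  -- at most `r / 2`. Up to time one the solution stays in the ball of radius `r / 2`, leaving the
  -- other half of `r` for the perturbation `ψ` below.
  set δ : ℝ := r / (2 * C) with hδ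
  have hδ0 : 0 < δ := by positivity
  have hCδ : C * δ = r / 2 := by rw [hδ]; field_simp
  have hδr : δ ≤ r / 2 := by nlinarith
  have hx : ∀ {v : E} {t : ℝ}, ‖v‖ < δ → t ∈ Icc (0 : ℝ) 1 → ‖x₀ + t • v - x₀‖ ≤ r := by
    intro v t hv ht
    rw [add_sub_cancel_left, norm_smul, Real.norm_eq_abs, abs_of_nonneg ht.1]
    nlinarith [ht.1, ht.2, norm_nonneg v]
  have hlip : ∀ {v : E} {t : ℝ}, ‖v‖ < δ → t ∈ Icc (0 : ℝ) 1 →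
      LipschitzOnWith (r / 2).toNNReal (fun y => f (x₀ + t • v, y) v) (closedBall y₀ r) := by
    intro v t hv ht
    refine LipschitzOnWith.of_dist_le_mul fun y hy y' hy' => ?_
    rw [mem_closedBall, dist_eq_norm] at hy hy'
    rw [dist_eq_norm, dist_eq_norm, Real.coe_toNNReal _ (by positivity)]
    have h1 := (convex_closedBall (x₀, y₀) r).norm_image_sub_le_of_norm_hasFDerivWithin_le
      (fun z hz => (hfd z hz).hasFDerivWithinAt) hdC (hmem (hx hv ht) hy') (hmem (hx hv ht) hy)
    have h2 : ‖((x₀ + t • v, y) : E × F) - (x₀ + t • v, y')‖ = ‖y - y'‖ := by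
      rw [Prod.mk_sub_mk, sub_self, Prod.norm_mk, norm_zero, max_eq_right (norm_nonneg _)]
    rw [h2] at h1
    rw [← sub_apply]
    refine (ContinuousLinearMap.le_opNorm _ _).trans ?_
    calc _ ≤ (C * ‖y - y'‖) * δ := by gcongr
      _ = _ := by rw [← hCδ]; ring
  have hsol : ∀ v : E, ‖v‖ < δ → ∃ α : ℝ → F, α 0 = y₀ ∧
      (∀ t, α t ∈ closedBall y₀ (r / 2)) ∧
      ∀ t ∈ Icc (0 : ℝ) 1, HasDerivWithinAt α (f (x₀ + t • v, α t) v) (Icc 0 1) t := by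
    intro v hv
    have hpl : IsPicardLindelof (fun t y => f (x₀ + t • v, y) v)
        (⟨0, by simp⟩ : Icc (0 : ℝ) 1) y₀ (r / 2).toNNReal 0 (r / 2).toNNReal
        (r / 2).toNNReal := by
      have hr2 : ((r / 2).toNNReal : ℝ) = r / 2 := Real.coe_toNNReal _ (by positivity)
      refine ⟨fun t ht => (hlip hv ht).mono ?_, fun y hy => ?_, fun t ht y hy => ?_, ?_⟩
      · rw [hr2]; exact closedBall_subset_closedBall (by linarith)
      · rw [hr2, mem_closedBall, dist_eq_norm] at hy
        intro t ht
        have h1 := (hfd _ (hmem (hx hv ht) (hy.trans (by linarith)))).continuousAt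
        have h2 : ContinuousAt (fun t : ℝ => f (x₀ + t • v, y)) t :=
          ContinuousAt.comp (f := fun t : ℝ => (x₀ + t • v, y)) h1 (by fun_prop)
        exact (h2.clm_apply continuousAt_const).continuousWithinAt
      · rw [hr2, mem_closedBall, dist_eq_norm] at hy
        rw [hr2, ← hCδ]
        refine (ContinuousLinearMap.le_opNorm _ _).trans ?_
        gcongr
        exact hfC _ (hmem (hx hv ht) (hy.trans (by linarith)))
      · rw [hr2]; simp
    obtain ⟨α, h1, h2, h3⟩ := exists_mem_closedBall_hasDerivWithinAt hpl
    rw [Real.coe_toNNReal _ (by positivity)] at h2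
    exact ⟨α, h1, h2, h3⟩
  choose! φ hφ0 hφm hφd using hsol
  have hIci : ∀ {g : ℝ → F} {g' : F} {t : ℝ}, t ∈ Ico (0 : ℝ) 1 →
      HasDerivWithinAt g g' (Icc 0 1) t → HasDerivWithinAt g g' (Ici t) t := by
    intro g g' t ht h
    refine h.mono_of_mem_nhdsWithin ?_
    exact mem_of_superset (Icc_mem_nhdsGE ht.2) (Icc_subset_Icc_left ht.1)
  -- The solution at `x` is the time-one value of the ordinary differential equation along the ray
  -- from `x₀` to `x`. At `x₀` the ray is constant, and so is the solution.
  refine ⟨ball x₀ δ, isOpen_ball, mem_ball_self hδ0, fun x => φ (x - x₀) 1, ?_, fun x hxδ => ?_⟩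
  · have hz : ‖(0 : E)‖ < δ := by simpa
    have h1 := (convex_Icc (0 : ℝ) 1).norm_image_sub_le_of_norm_hasDerivWithin_le
      (f := φ 0) (C := 0) (fun t ht => hφd 0 hz t ht) (by simp)
      (left_mem_Icc.2 zero_le_one) (right_mem_Icc.2 zero_le_one)
    rw [zero_mul, norm_le_zero_iff, sub_eq_zero] at h1
    simp only [sub_self]
    rw [h1, hφ0 0 hz]
  set v := x - x₀ with hv
  have hvδ : ‖v‖ < δ := by rwa [mem_ball, dist_eq_norm] at hxδ
  have hxv : x = x₀ + (1 : ℝ) • v := by simp [hv]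
  have hφr : ∀ {u : E}, ‖u‖ < δ → ∀ t, ‖φ u t - y₀‖ ≤ r / 2 := fun {u} hu t => by
    simpa [dist_eq_norm] using hφm u hu t
  have hγ : ∀ {t : ℝ}, t ∈ Icc (0 : ℝ) 1 → (x₀ + t • v, φ v t) ∈ closedBall (x₀, y₀) r :=
    fun {t} ht => hmem (hx hvδ ht) ((hφr hvδ t).trans (by linarith))
  have h1I : (1 : ℝ) ∈ Icc (0 : ℝ) 1 := right_mem_Icc.2 zero_le_one
  refine ⟨hrW (by simpa only [← hxv] using hγ h1I), ?_⟩
  set D : ℝ := C ^ 3 * δ + C ^ 2 with hD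
  -- the comparison of the solutions in the directions `v` and `v + h`
  have main : ∀ h : E, ‖v + h‖ < δ → C * ‖h‖ ≤ r / 2 →
      ‖φ (v + h) 1 - φ v 1 - f (x, φ v 1) h‖ ≤
        (D * gronwallBound 0 (r / 2) 1 1) * ‖h‖ ^ 2 := by
    intro h hvh hh
    -- First-order guess for the solution in direction `v + h`: at time `t` the base point moves by
    -- `t • h`, so the value should move by `f` applied to `t • h`.
    set ψ : ℝ → F := fun t => φ v t + t • f (x₀ + t • v, φ v t) h with hψ
    set ψ' : ℝ → F := fun t => f (x₀ + t • v, φ v t) v + (f (x₀ + t • v, φ v t) h +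
      t • fderiv ℝ f (x₀ + t • v, φ v t) (v, f (x₀ + t • v, φ v t) v) h) with hψ'
    have hfh : ∀ {t : ℝ}, t ∈ Icc (0 : ℝ) 1 → ‖f (x₀ + t • v, φ v t) h‖ ≤ C * ‖h‖ :=
      fun {t} ht => (ContinuousLinearMap.le_opNorm _ _).trans
        (by gcongr; exact hfC _ (hγ ht))
    have hψm : ∀ {t : ℝ}, t ∈ Icc (0 : ℝ) 1 → ‖ψ t - y₀‖ ≤ r := by
      intro t ht
      have : ψ t - y₀ = (φ v t - y₀) + t • f (x₀ + t • v, φ v t) h := by simp only [hψ]; abel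
      rw [this]
      refine (norm_add_le _ _).trans ?_
      rw [norm_smul, Real.norm_eq_abs, abs_of_nonneg ht.1]
      nlinarith [hφr hvδ t, hfh ht, ht.1, ht.2, norm_nonneg (f (x₀ + t • v, φ v t) h)]
    have hψd : ∀ t ∈ Icc (0 : ℝ) 1, HasDerivWithinAt ψ (ψ' t) (Icc 0 1) t := by
      intro t ht
      have e1 : HasDerivWithinAt (fun t : ℝ => (x₀ + t • v, φ v t))
          (v, f (x₀ + t • v, φ v t) v) (Icc 0 1) t := by
        have := ((hasDerivWithinAt_id t (Icc (0 : ℝ) 1)).smul_const v).const_add x₀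
        simp only [one_smul] at this
        exact this.prodMk (hφd v hvδ t ht)
      have e2 := (hfd _ (hγ ht)).comp_hasDerivWithinAt t e1
      have e3 := e2.clm_apply (hasDerivWithinAt_const t (Icc (0 : ℝ) 1) h)
      have e4 := (hφd v hvδ t ht).add ((hasDerivWithinAt_id t (Icc (0 : ℝ) 1)).smul e3)
      refine e4.congr_deriv ?_
      simp only [hψ', map_zero, add_zero, one_smul, Function.comp_def, id]
      abel
    have herr : ∀ t ∈ Ico (0 : ℝ) 1,
        dist (ψ' t) (f (x₀ + t • (v + h), ψ t) (v + h)) ≤ D * ‖h‖ ^ 2 := by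
      intro t ht'
      have ht := Ico_subset_Icc_self ht'
      set z : E × F := (x₀ + t • v, φ v t) with hz
      set k : E × F := (h, f z h) with hk
      have hzk : ((x₀ + t • (v + h), ψ t) : E × F) = z + t • k := by
        simp only [hz, hk, hψ, Prod.smul_mk, Prod.mk_add_mk, smul_add, add_assoc]
      have hzm : z + t • k ∈ closedBall (x₀, y₀) r := hzk ▸ hmem (hx hvh ht) (hψm ht)
      have hkn : ‖k‖ ≤ C * ‖h‖ :=
        max_le (le_mul_of_one_le_left (norm_nonneg h) hC) (hfh ht)
      have htk : ‖t • k‖ ≤ C * ‖h‖ := by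
        rw [norm_smul, Real.norm_eq_abs, abs_of_nonneg ht.1]
        nlinarith [ht.1, ht.2, norm_nonneg k]
      have hT1 := hT z (hγ ht) _ hzm
      rw [add_sub_cancel_left] at hT1
      have hs := hsymm z (hrW (hγ ht)) v h
      rw [hzk, dist_eq_norm, ← norm_neg]
      -- The symmetry condition `hs` cancels the terms that are linear in `h`. What remains is a
      -- Taylor remainder and a term bilinear in `k` and `h`, both quadratic in `h`.
      have expr : -(ψ' t - f (z + t • k) (v + h)) =
          (f (z + t • k) - f z - fderiv ℝ f z (t • k)) (v + h) + t • fderiv ℝ f z k h := by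
        simp only [hψ', ← hz, hs, ← hk, sub_apply, map_add, map_smul,
          smul_apply]
        module
      rw [expr]
      refine (norm_add_le _ _).trans ?_
      have b1 : ‖(f (z + t • k) - f z - fderiv ℝ f z (t • k)) (v + h)‖ ≤
          (C * (C * ‖h‖) ^ 2) * δ := by
        refine (ContinuousLinearMap.le_opNorm _ _).trans ?_
        have : C * ‖t • k‖ ^ 2 ≤ C * (C * ‖h‖) ^ 2 := by gcongr
        gcongr
        exact hT1.trans this
      have b2 : ‖t • fderiv ℝ f z k h‖ ≤ (C * (C * ‖h‖)) * ‖h‖ := by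
        have c1 : ‖fderiv ℝ f z k h‖ ≤ (C * (C * ‖h‖)) * ‖h‖ := by
          refine (ContinuousLinearMap.le_opNorm _ _).trans ?_
          gcongr
          refine (ContinuousLinearMap.le_opNorm _ _).trans ?_
          gcongr
          exact hdC _ (hγ ht)
        rw [norm_smul, Real.norm_eq_abs, abs_of_nonneg ht.1]
        nlinarith [ht.1, ht.2, norm_nonneg (fderiv ℝ f z k h)]
      calc _ ≤ (C * (C * ‖h‖) ^ 2) * δ + (C * (C * ‖h‖)) * ‖h‖ := add_le_add b1 b2
        _ = D * ‖h‖ ^ 2 := by rw [hD]; ring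
    -- Gronwall compares the approximate solution `ψ` with the exact one; at time one this is the
    -- differentiability estimate at `x`, so no differentiable dependence on parameters has to be
    -- invoked.
    have hG := dist_le_of_approx_trajectories_ODE_of_mem (a := (0 : ℝ)) (b := 1)
      (v := fun t y => f (x₀ + t • (v + h), y) (v + h)) (s := fun _ => closedBall y₀ r)
      (K := (r / 2).toNNReal) (f := ψ) (g := φ (v + h)) (f' := ψ')
      (g' := fun t => f (x₀ + t • (v + h), φ (v + h) t) (v + h)) (εf := D * ‖h‖ ^ 2) (εg := 0)
      (δ := 0)
      (fun t ht => hlip hvh (Ico_subset_Icc_self ht))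
      (fun t ht => (hψd t ht).continuousWithinAt)
      (fun t ht => hIci ht (hψd t (Ico_subset_Icc_self ht)))
      herr
      (fun t ht => by simpa [dist_eq_norm] using hψm (Ico_subset_Icc_self ht))
      (fun t ht => (hφd _ hvh t ht).continuousWithinAt)
      (fun t ht => hIci ht (hφd _ hvh t (Ico_subset_Icc_self ht)))
      (fun t ht => by simp)
      (fun t ht => closedBall_subset_closedBall (by linarith) (hφm _ hvh t))
      (by simp [hψ, hφ0 _ hvδ, hφ0 _ hvh]) 1 h1I
    rw [add_zero, gronwallBound_zero_eq_mul, Real.coe_toNNReal _ (by positivity), sub_zero,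
      dist_comm, dist_eq_norm] at hG
    have e : φ (v + h) 1 - ψ 1 = φ (v + h) 1 - φ v 1 - f (x, φ v 1) h := by
      simp only [hψ, one_smul, hxv]
      rw [sub_sub]
    rw [e] at hG
    linarith
  rw [hasFDerivAt_iff_isLittleO_nhds_zero]
  refine Asymptotics.IsBigO.trans_isLittleO (g := fun h : E => ‖h‖ ^ 2) ?_
    (Asymptotics.isLittleO_norm_pow_id one_lt_two)
  refine Asymptotics.IsBigO.of_bound (D * gronwallBound 0 (r / 2) 1 1) ?_
  have n1 : ∀ᶠ h : E in 𝓝 0, ‖v + h‖ < δ := by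
    have : ContinuousAt (fun h : E => ‖v + h‖) 0 := by fun_prop
    exact this.eventually_lt_const (by simpa using hvδ)
  have n2 : ∀ᶠ h : E in 𝓝 0, C * ‖h‖ < r / 2 := by
    have : ContinuousAt (fun h : E => C * ‖h‖) 0 := by fun_prop
    exact this.eventually_lt_const (by simpa using hr)
  filter_upwards [n1, n2] with h h1 h2
  have := main h h1 h2.le
  rw [Real.norm_of_nonneg (by positivity : (0 : ℝ) ≤ ‖h‖ ^ 2)]
  have e : x + h - x₀ = v + h := by rw [hv]; abel
  rw [e]
  exact this

/-- A solution of a total differential equation with smooth right hand side is smooth. -/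
theorem contDiffOn_of_hasFDerivAt_comp {f : E × F → E →L[ℝ] F} {W : Set (E × F)}
    (hf : ContDiffOn ℝ ∞ f W) {U : Set E} (hU : IsOpen U) {y : E → F}
    (hy : ∀ x ∈ U, (x, y x) ∈ W ∧ HasFDerivAt y (f (x, y x)) x) : ContDiffOn ℝ ∞ y U := by
  -- Bootstrapping: if `y` is of class `C^n`, then so is its derivative `f (x, y x)`, and `y` is of
  -- class `C^(n+1)`.
  refine contDiffOn_infty.2 fun n => ?_
  induction n with
  | zero => exact contDiffOn_zero.2 fun x hx => (hy x hx).2.continuousAt.continuousWithinAt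
  | succ n ih =>
    rw [Nat.cast_succ, contDiffOn_succ_iff_fderiv_of_isOpen hU]
    refine ⟨fun x hx => (hy x hx).2.differentiableAt.differentiableWithinAt, by simp, ?_⟩
    have : ContDiffOn ℝ n (fun x => f (x, y x)) U :=
      (hf.of_le (by exact_mod_cast le_top)).comp (contDiffOn_id.prodMk ih) fun x hx => (hy x hx).1
    exact this.congr fun x hx => (hy x hx).2.fderiv

end Frobenius

/-! ### Basic properties of principal bundles -/

section Basic

open Set Filter Topology

variable {EM HM EG HG EP HP M G P : Type*}
  [NormedAddCommGroup EM] [NormedSpace ℝ EM] [TopologicalSpace HM]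
  [NormedAddCommGroup EG] [NormedSpace ℝ EG] [TopologicalSpace HG]
  [NormedAddCommGroup EP] [NormedSpace ℝ EP] [TopologicalSpace HP]
  {IM : ModelWithCorners ℝ EM HM} {IG : ModelWithCorners ℝ EG HG} {IP : ModelWithCorners ℝ EP HP}
  [TopologicalSpace M] [ChartedSpace HM M]
  [TopologicalSpace G] [ChartedSpace HG G] [Group G]
  [TopologicalSpace P] [ChartedSpace HP P] [MulAction Gᵐᵒᵖ P] {π : P → M}

namespace IsPrincipalBundle

/-- An equivariant trivialization in terms of the action. -/
theorem apply_act (hP : IsPrincipalBundle (G := G) IM IG IP π) {e : Bundle.Trivialization G π}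
    (he : ∀ p ∈ e.source, ∀ g : G, (e (op g • p)).2 = (e p).2 * g) {p : P} (hp : π p ∈ e.baseSet)
    (g : G) : e (op g • p) = (π p, (e p).2 * g) := by
  refine Prod.ext ?_ (he p (e.mem_source.2 hp) g)
  rw [e.coe_fst' (by rwa [hP.proj_act]), hP.proj_act]

theorem act_eq_symm (hP : IsPrincipalBundle (G := G) IM IG IP π) {e : Bundle.Trivialization G π}
    (he : ∀ p ∈ e.source, ∀ g : G, (e (op g • p)).2 = (e p).2 * g) {p : P} (hp : π p ∈ e.baseSet)
    (g : G) : op g • p = e.toOpenPartialHomeomorph.symm (π p, (e p).2 * g) := by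
  rw [← hP.apply_act he hp g]
  exact (e.toOpenPartialHomeomorph.left_inv (e.mem_source.2 (by rwa [hP.proj_act]))).symm

/-- The action is free because in an equivariant trivialization it is right multiplication on the
second coordinate. -/
theorem act_injective (hP : IsPrincipalBundle (G := G) IM IG IP π) (p : P) :
    Function.Injective fun g : G => op g • p := by
  intro g h hgh
  obtain ⟨e, hx, -, -, he⟩ := hP.locally_trivial (π p)
  have h1 := he p (e.mem_source.2 hx) g
  have h2 := he p (e.mem_source.2 hx) h
  simp only at hgh
  rw [hgh, h2] at h1
  exact (mul_left_cancel h1).symm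

theorem act_translation_of_trivialization (hP : IsPrincipalBundle (G := G) IM IG IP π)
    {e : Bundle.Trivialization G π}
    (he : ∀ p ∈ e.source, ∀ g : G, (e (op g • p)).2 = (e p).2 * g) {p q : P} (hpq : π p = π q)
    (hp : π p ∈ e.baseSet) : op ((e p).2⁻¹ * (e q).2) • p = q := by
  rw [hP.act_eq_symm he hp, mul_inv_cancel_left, hpq]
  exact e.symm_apply_mk_proj (e.mem_source.2 (hpq ▸ hp))

theorem exists_act_eq (hP : IsPrincipalBundle (G := G) IM IG IP π) {p q : P} (hpq : π p = π q) :
    ∃ g : G, op g • p = q := by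
  obtain ⟨e, hx, -, -, he⟩ := hP.locally_trivial (π p)
  exact ⟨_, hP.act_translation_of_trivialization he hpq hx⟩

end IsPrincipalBundle

open Classical in
variable (G) in
/-- The element `g` of the structure group with `p · g = q`, if it exists. -/
def translation (p q : P) : G := if h : ∃ g : G, op g • p = q then h.choose else 1

namespace IsPrincipalBundle

theorem act_translation (hP : IsPrincipalBundle (G := G) IM IG IP π) {p q : P}
    (hpq : π p = π q) : op (translation G p q) • p = q := by
  have h := hP.exists_act_eq hpq
  rw [translation, dif_pos h]
  exact h.choose_spec

theorem translation_eq (hP : IsPrincipalBundle (G := G) IM IG IP π) {p q : P} {g : G}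
    (h : op g • p = q) : translation G p q = g :=
  hP.act_injective p ((hP.act_translation (by rw [← h, hP.proj_act])).trans h.symm)

theorem translation_mul (hP : IsPrincipalBundle (G := G) IM IG IP π) {p q r : P}
    (hpq : π p = π q) (hqr : π q = π r) :
    translation G p q * translation G q r = translation G p r :=
  (hP.translation_eq (by
    rw [op_mul, mul_smul, hP.act_translation hpq, hP.act_translation hqr])).symm

theorem translation_act (hP : IsPrincipalBundle (G := G) IM IG IP π) {p q : P}
    (hpq : π p = π q) (g : G) : translation G p (op g • q) = translation G p q * g :=
  hP.translation_eq (by rw [op_mul, mul_smul, hP.act_translation hpq])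

theorem contMDiff_proj (hP : IsPrincipalBundle (G := G) IM IG IP π) :
    ContMDiff IP IM ∞ π := by
  intro p
  obtain ⟨e, hx, h1, -, -⟩ := hP.locally_trivial (π p)
  have hs : e.source ∈ 𝓝 p := e.open_source.mem_nhds (e.mem_source.2 hx)
  refine ((h1.contMDiffAt hs).fst).congr_of_eventuallyEq ?_
  filter_upwards [hs] with q hq using (e.coe_fst hq).symm

variable [LieGroup IG ∞ G]

theorem contMDiff_act (hP : IsPrincipalBundle (G := G) IM IG IP π) :
    ContMDiff (IP.prod IG) IP ∞ (fun a : P × G => op a.2 • a.1) := by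
  intro a
  obtain ⟨e, hx, h1, h2, he⟩ := hP.locally_trivial (π a.1)
  have hs : e.source ∈ 𝓝 a.1 := e.open_source.mem_nhds (e.mem_source.2 hx)
  have hs' : Prod.fst ⁻¹' e.source ∈ 𝓝 a := continuousAt_fst hs
  have k1 : ContMDiffAt (IP.prod IG) (IM.prod IG) ∞
      (fun b : P × G => (π b.1, (e b.1).2 * b.2)) a := by
    refine ContMDiffAt.prodMk ?_ (ContMDiffAt.mul ?_ contMDiffAt_snd)
    · exact hP.contMDiff_proj.contMDiffAt.comp a contMDiffAt_fst
    · exact ((h1.contMDiffAt hs).comp a contMDiffAt_fst).snd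
  have k2 : ContMDiffAt (IM.prod IG) IP ∞ e.toOpenPartialHomeomorph.symm
      (π a.1, (e a.1).2 * a.2) :=
    h2.contMDiffAt (e.open_target.mem_nhds (e.mem_target.2 hx))
  refine (k2.comp a k1).congr_of_eventuallyEq ?_
  filter_upwards [hs'] with b hb using hP.act_eq_symm he (e.mem_source.1 hb) _

variable {EN HN N : Type*} [NormedAddCommGroup EN] [NormedSpace ℝ EN] [TopologicalSpace HN]
  {IN : ModelWithCorners ℝ EN HN} [TopologicalSpace N] [ChartedSpace HN N]

theorem contMDiffAt_act (hP : IsPrincipalBundle (G := G) IM IG IP π) {a : N → P} {g : N → G}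
    {x : N} (ha : ContMDiffAt IN IP ∞ a x) (hg : ContMDiffAt IN IG ∞ g x) :
    ContMDiffAt IN IP ∞ (fun y => op (g y) • a y) x :=
  ContMDiffAt.comp x (g := fun a : P × G => op a.2 • a.1) (f := fun y => (a y, g y))
    hP.contMDiff_act.contMDiffAt (ha.prodMk hg)

/-- In an equivariant trivialization `e` the translation from `p` to `q` is `(e p).2⁻¹ * (e q).2`,
which is visibly smooth. -/
theorem contMDiffAt_translation (hP : IsPrincipalBundle (G := G) IM IG IP π) {a b : N → P}
    {x : N} (ha : ContMDiffAt IN IP ∞ a x) (hb : ContMDiffAt IN IP ∞ b x)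
    (hab : ∀ᶠ y in 𝓝 x, π (a y) = π (b y)) :
    ContMDiffAt IN IG ∞ (fun y => translation G (a y) (b y)) x := by
  obtain ⟨e, hx, h1, h2, he⟩ := hP.locally_trivial (π (a x))
  have hs : e.source ∈ 𝓝 (a x) := e.open_source.mem_nhds (e.mem_source.2 hx)
  have hs' : e.source ∈ 𝓝 (b x) :=
    e.open_source.mem_nhds (e.mem_source.2 (hab.self_of_nhds ▸ hx))
  have ka := ((h1.contMDiffAt hs).comp x ha).snd
  have kb := ((h1.contMDiffAt hs').comp x hb).snd
  refine (ka.inv.mul kb).congr_of_eventuallyEq ?_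
  filter_upwards [hab, ha.continuousAt hs] with y hy hy'
  exact hP.translation_eq (hP.act_translation_of_trivialization he hy (e.mem_source.1 hy'))

end IsPrincipalBundle

/-! ### The Maurer-Cartan form and the product rule for connections -/

variable (IG) in
/-- The (left) Maurer-Cartan form of a Lie group. -/
def maurerCartan (g : G) : TangentSpace IG g →L[ℝ] GroupLieAlgebra IG G :=
  (mfderiv IG IG (fun h : G => g⁻¹ * h) g : EG →L[ℝ] EG)

theorem adjointAction_zero (g : G) : adjointAction IG g (0 : GroupLieAlgebra IG G) = 0 :=
  map_zero (mfderiv IG IG (fun h : G => g * h * g⁻¹) 1)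

section Smooth

variable [LieGroup IG ∞ G]

/-- Left translations by `g` and `g⁻¹` are inverse to each other, hence so are their derivatives.
This makes the Maurer-Cartan form injective, so that it detects the vanishing of the derivative of a
`G`-valued map. -/
theorem mfderiv_mul_left_comp_maurerCartan (g : G) (w : TangentSpace IG g) :
    (mfderiv IG IG (fun h : G => g * h) 1 (maurerCartan IG g w) : EG) = w := by
  have h1 : MDifferentiableAt IG IG (fun h : G => g⁻¹ * h) g :=
    (contMDiff_mul_left (n := ∞)).mdifferentiableAt (by simp)
  have h2 : MDifferentiableAt IG IG (fun h : G => g * h) (g⁻¹ * g) :=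
    (contMDiff_mul_left (n := ∞)).mdifferentiableAt (by simp)
  have h3 := mfderiv_comp g h2 h1
  have h4 : (fun h : G => g * h) ∘ (fun h : G => g⁻¹ * h) = id := by ext h; simp
  rw [h4, mfderiv_id] at h3
  have h5 := congrArg (fun L : EG →L[ℝ] EG => L w) h3
  have h6 : mfderiv IG IG (fun h : G => g * h) (g⁻¹ * g) =
    (mfderiv IG IG (fun h : G => g * h) 1 : EG →L[ℝ] EG) := by rw [inv_mul_cancel]
  rw [h6] at h5
  exact h5.symm

theorem maurerCartan_injective (g : G) {w : TangentSpace IG g} (hw : maurerCartan IG g w = 0) :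
    w = 0 := by
  have h := mfderiv_mul_left_comp_maurerCartan g w
  rw [hw] at h
  exact h.symm.trans (map_zero (mfderiv IG IG (fun h : G => g * h) 1))

variable {EN HN N : Type*} [NormedAddCommGroup EN] [NormedSpace ℝ EN] [TopologicalSpace HN]
  {IN : ModelWithCorners ℝ EN HN} [TopologicalSpace N] [ChartedSpace HN N]

/-- The velocity of an orbit map is a fundamental vector. -/
theorem mfderiv_act_eq_fundamentalVector (hP : IsPrincipalBundle (G := G) IM IG IP π) (p : P)
    (g : G) (w : TangentSpace IG g) :
    (mfderiv IG IP (fun h : G => op h • p) g w : EP) =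
      fundamentalVector G IG IP (maurerCartan IG g w) (op g • p) := by
  have h1 : MDifferentiableAt IG IG (fun h : G => g⁻¹ * h) g :=
    (contMDiff_mul_left (n := ∞)).mdifferentiableAt (by simp)
  have h2 : MDifferentiableAt IG IP (fun h : G => op h • op g • p) (g⁻¹ * g) :=
    (hP.contMDiffAt_act (contMDiffAt_const (n := ∞) (c := op g • p))
      contMDiffAt_id).mdifferentiableAt (by simp)
  have h3 := mfderiv_comp g h2 h1
  -- The orbit map of `p` factors as left translation by `g⁻¹` followed by the orbit map of `p · g`,
  -- which brings the derivative at `g` to the identity.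
  have h4 : (fun h : G => op h • op g • p) ∘ (fun h : G => g⁻¹ * h) = fun h : G => op h • p := by
    ext h
    simp [← mul_smul, ← op_mul]
  rw [h4] at h3
  have h6 : mfderiv IG IP (fun h : G => op h • op g • p) (g⁻¹ * g) =
    (mfderiv IG IP (fun h : G => op h • op g • p) 1 : EG →L[ℝ] EP) := by rw [inv_mul_cancel]
  rw [h6] at h3
  exact congrArg (fun L : EG →L[ℝ] EP => L w) h3

/-- The product rule for connection forms. -/
theorem IsConnection.apply_mfderiv_act [IsManifold IP ∞ P]
    (hP : IsPrincipalBundle (G := G) IM IG IP π)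
    {A : ∀ p : P, TangentSpace IP p →L[ℝ] GroupLieAlgebra IG G} (hA : IsConnection IG IP A)
    {a : N → P} {g : N → G} {x : N} (ha : MDifferentiableAt IN IP a x)
    (hg : MDifferentiableAt IN IG g x) (u : TangentSpace IN x) :
    A (op (g x) • a x) (mfderiv IN IP (fun y => op (g y) • a y) x u) =
      adjointAction IG (g x)⁻¹ (A (a x) (mfderiv IN IP a x u)) +
        maurerCartan IG (g x) (mfderiv IN IG g x u) := by
  have hact : MDifferentiableAt (IP.prod IG) IP (fun b : P × G => op b.2 • b.1) (a x, g x) :=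
    hP.contMDiff_act.mdifferentiableAt (by simp)
  have h1 : mfderiv IN IP (fun y => op (g y) • a y) x u =
      mfderiv (IP.prod IG) IP (fun b : P × G => op b.2 • b.1) (a x, g x)
        (mfderiv IN IP a x u, mfderiv IN IG g x u) := by
    have := mfderiv_comp x (f := fun y => (a y, g y)) hact (ha.prodMk hg)
    rw [ha.mfderiv_prod hg] at this
    exact congrArg (fun L : EN →L[ℝ] EP => L u) this
  have h2 := mfderiv_act_eq_fundamentalVector hP (a x) (g x) (mfderiv IN IG g x u)
  -- The derivative of the action splits into two partial derivatives: equivariance of `A` evaluates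
  -- the one along `P`, and reproduction of the generators the one along `G`.
  refine (congrArg (A (op (g x) • a x)) (h1.trans (mfderiv_prod_eq_add_apply hact))).trans ?_
  refine (map_add (A (op (g x) • a x)) _ _).trans ?_
  exact congrArg₂ _ (hA.equivariant (g x) (a x) _)
    ((congrArg (A (op (g x) • a x)) h2).trans (hA.fundamental _ _))

end Smooth

/-! ### Maps with vanishing derivative -/

/-- Read in charts, the map has zero derivative on a ball of the model space; the mean value
inequality makes it constant there, and injectivity of the target chart transfers this back. -/
theorem eventually_eq_of_mfderiv_eq_zero {EN HN N : Type*} [NormedAddCommGroup EN]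
    [NormedSpace ℝ EN] [TopologicalSpace HN] {IN : ModelWithCorners ℝ EN HN} [TopologicalSpace N]
    [ChartedSpace HN N] [IM.Boundaryless] [IsManifold IM 1 M] [IsManifold IN 1 N] {f : M → N}
    {x : M} (hf : ∀ᶠ y in 𝓝 x, MDifferentiableAt IM IN f y ∧ mfderiv IM IN f y = 0) :
    ∀ᶠ y in 𝓝 x, f y = f x := by
  set χ := extChartAt IM x
  set c := extChartAt IN (f x)
  have hfx : ContinuousAt f x := hf.self_of_nhds.1.continuousAt
  have hO : ∀ᶠ y in 𝓝 x, (MDifferentiableAt IM IN f y ∧ mfderiv IM IN f y = 0) ∧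
      f y ∈ c.source :=
    hf.and (hfx.preimage_mem_nhds (extChartAt_source_mem_nhds (f x)))
  have hχ : ContinuousAt χ.symm (χ x) := continuousAt_extChartAt_symm x
  have hO' : ∀ᶠ z in 𝓝 (χ x), ((MDifferentiableAt IM IN f (χ.symm z) ∧
      mfderiv IM IN f (χ.symm z) = 0) ∧ f (χ.symm z) ∈ c.source) ∧ z ∈ χ.target := by
    refine Filter.Eventually.and ?_ (extChartAt_target_mem_nhds x)
    have h1 : Tendsto χ.symm (𝓝 (χ x)) (𝓝 x) := by
      have := hχ.tendsto
      rwa [extChartAt_to_inv x] at this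
    exact h1.eventually hO
  obtain ⟨r, hr, hball⟩ := Metric.eventually_nhds_iff_ball.1 hO'
  have hd : ∀ z ∈ Metric.ball (χ x) r,
      HasFDerivAt (fun z => c (f (χ.symm z))) (0 : EM →L[ℝ] EN) z := by
    intro z hz
    obtain ⟨⟨⟨h1, h2⟩, h3⟩, h4⟩ := hball z hz
    have k1 : HasMFDerivAt 𝓘(ℝ, EM) IM χ.symm z (mfderiv 𝓘(ℝ, EM) IM χ.symm z) := by
      refine MDifferentiableAt.hasMFDerivAt ?_
      have := (contMDiffOn_extChartAt_symm (n := 1) (I := IM) x).contMDiffAt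
        ((isOpen_extChartAt_target x).mem_nhds h4)
      exact this.mdifferentiableAt (by simp)
    have k2 := h1.hasMFDerivAt
    rw [h2] at k2
    have k3 : HasMFDerivAt IN 𝓘(ℝ, EN) c (f (χ.symm z)) (mfderiv IN 𝓘(ℝ, EN) c (f (χ.symm z))) :=
      (mdifferentiableAt_extChartAt (by rwa [extChartAt_source] at h3)).hasMFDerivAt
    have k4 := HasMFDerivAt.comp z (f := f ∘ χ.symm) k3 (k2.comp z k1)
    refine k4.hasFDerivAt.congr_fderiv ?_
    ext v
    exact map_zero (mfderiv IN 𝓘(ℝ, EN) c (f (χ.symm z)))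
  have hconst : ∀ z ∈ Metric.ball (χ x) r, c (f (χ.symm z)) = c (f x) := by
    intro z hz
    have h1 := (convex_ball (χ x) r).norm_image_sub_le_of_norm_hasFDerivWithin_le (C := 0)
      (fun z hz => (hd z hz).hasFDerivWithinAt) (by simp) (Metric.mem_ball_self hr) hz
    rw [zero_mul, norm_le_zero_iff, sub_eq_zero, extChartAt_to_inv x] at h1
    exact h1
  have hχx : ContinuousAt χ x := continuousAt_extChartAt x
  filter_upwards [hχx.preimage_mem_nhds (Metric.ball_mem_nhds _ hr), hO,
    extChartAt_source_mem_nhds (I := IM) x] with y h1 h2 h3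
  have h4 := hconst _ h1
  rw [χ.left_inv h3] at h4
  exact c.injOn h2.2 (mem_extChartAt_source (f x)) h4

end Basic

/-! ### Local horizontal sections of flat connections -/

section Pfaff

variable {E F W : Type*} [NormedAddCommGroup E] [NormedSpace ℝ E]
  [NormedAddCommGroup F] [NormedSpace ℝ F] [NormedAddCommGroup W] [NormedSpace ℝ W]

/-- **Frobenius theorem** for a Pfaffian system `α = 0` on a product, whose kernel is a complement
of the second factor and is closed under Lie brackets: there are local integral manifolds which are
graphs over the first factor. -/
theorem exists_integral_graph [CompleteSpace F]
    {α : E × F → E × F →L[ℝ] W} {Ω : Set (E × F)} (hΩ : IsOpen Ω) (hα : ContDiffOn ℝ ∞ α Ω)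
    (hinv : ∀ z ∈ Ω, (α z ∘L ContinuousLinearMap.inr ℝ E F).IsInvertible)
    (hbr : ∀ X Y : E × F → E × F, ContDiffOn ℝ ∞ X Ω → ContDiffOn ℝ ∞ Y Ω →
      (∀ z ∈ Ω, α z (X z) = 0) → (∀ z ∈ Ω, α z (Y z) = 0) →
      ∀ z ∈ Ω, α z (VectorField.lieBracket ℝ X Y z) = 0)
    {x₀ : E} {y₀ : F} (h0 : (x₀, y₀) ∈ Ω) :
    ∃ U : Set E, IsOpen U ∧ x₀ ∈ U ∧ ∃ y : E → F, y x₀ = y₀ ∧ ContDiffOn ℝ ∞ y U ∧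
      ∀ x ∈ U, (x, y x) ∈ Ω ∧ ∀ v, α (x, y x) (v, fderiv ℝ y x v) = 0 := by
  set C : E × F → F →L[ℝ] W := fun z => α z ∘L ContinuousLinearMap.inr ℝ E F with hC
  -- The equation `α z (v, w) = 0` solved for `w`, so that the kernel of `α z` is the graph of `f
  -- z`.
  set f : E × F → E →L[ℝ] F := fun z =>
    -((C z).inverse ∘L (α z ∘L ContinuousLinearMap.inl ℝ E F)) with hf
  have hCs : ContDiffOn ℝ ∞ C Ω := hα.clm_comp contDiffOn_const
  have hCi : ContDiffOn ℝ ∞ (fun z => (C z).inverse) Ω := fun z hz =>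
    (ContDiffAt.comp z (g := ContinuousLinearMap.inverse) (hinv z hz).contDiffAt_map_inverse
      (hCs.contDiffAt (hΩ.mem_nhds hz))).contDiffWithinAt
  have hfs : ContDiffOn ℝ ∞ f Ω :=
    (hCi.clm_comp (hα.clm_comp contDiffOn_const)).neg
  have hα0 : ∀ z ∈ Ω, ∀ v, α z (v, f z v) = 0 := by
    intro z hz v
    have h1 : α z (v, f z v) = α z (v, 0) + C z (f z v) := by
      simp only [hC, ContinuousLinearMap.comp_apply, ContinuousLinearMap.inr_apply]
      rw [← map_add]
      simp
    obtain ⟨e, he⟩ := hinv z hz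
    have he' : C z = e := he.symm
    rw [h1]
    simp [hf, he']
  have hinj : ∀ z ∈ Ω, ∀ w : F, α z (0, w) = 0 → w = 0 := by
    intro z hz w hw
    obtain ⟨e, he⟩ := hinv z hz
    have h1 : (e : F →L[ℝ] W) w = 0 := by rw [he]; exact hw
    simpa using h1
  -- The fields `z ↦ (v, f z v)` with `v` fixed lie in the kernel. Their bracket has vanishing first
  -- component and lies in the kernel too, so its second component vanishes; that component is the
  -- difference of the two sides.
  have hsymm : ∀ z ∈ Ω, ∀ v w, fderiv ℝ f z (v, f z v) w = fderiv ℝ f z (w, f z w) v := by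
    intro z hz v w
    have hX : ∀ v : E, ContDiffOn ℝ ∞ (fun z => (v, f z v)) Ω := fun v =>
      contDiffOn_const.prodMk (hfs.clm_apply contDiffOn_const)
    have hfd : HasFDerivAt f (fderiv ℝ f z) z :=
      ((hfs.contDiffAt (hΩ.mem_nhds hz)).differentiableAt (by simp)).hasFDerivAt
    have hXd : ∀ v u, fderiv ℝ (fun z => (v, f z v)) z u = (0, fderiv ℝ f z u v) := by
      intro v u
      rw [((hasFDerivAt_const v z).prodMk (hfd.clm_apply (hasFDerivAt_const v z))).fderiv]
      simp
    have h1 := hbr _ _ (hX v) (hX w) (fun z hz => hα0 z hz v) (fun z hz => hα0 z hz w) z hz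
    rw [VectorField.lieBracket, hXd, hXd, Prod.mk_sub_mk, sub_zero] at h1
    exact sub_eq_zero.1 (hinj z hz _ h1)
  obtain ⟨U, hU, hxU, y, hy0, hy⟩ := exists_hasFDerivAt_of_symmetric hΩ
    (hfs.of_le ENat.LEInfty.out) hsymm h0
  refine ⟨U, hU, hxU, y, hy0, contDiffOn_of_hasFDerivAt_comp hfs hU hy, fun x hx =>
    ⟨(hy x hx).1, fun v => ?_⟩⟩
  rw [(hy x hx).2.fderiv]
  exact hα0 _ (hy x hx).1 v

end Pfaff

/-! ### Flat connection forms in local coordinates -/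

section Flat

open Set Filter Topology

variable {EM HM EG HG EP HP M G P E : Type*}
  [NormedAddCommGroup EM] [NormedSpace ℝ EM] [TopologicalSpace HM]
  [NormedAddCommGroup EG] [NormedSpace ℝ EG] [TopologicalSpace HG]
  [NormedAddCommGroup EP] [NormedSpace ℝ EP] [TopologicalSpace HP]
  [NormedAddCommGroup E] [NormedSpace ℝ E]
  {IM : ModelWithCorners ℝ EM HM} {IG : ModelWithCorners ℝ EG HG} {IP : ModelWithCorners ℝ EP HP}
  [TopologicalSpace M] [ChartedSpace HM M]
  [TopologicalSpace G] [ChartedSpace HG G] [Group G]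
  [TopologicalSpace P] [ChartedSpace HP P]

theorem mlieBracket_eq_lieBracket {X Y : ∀ z : E, TangentSpace 𝓘(ℝ, E) z} :
    VectorField.mlieBracket 𝓘(ℝ, E) X Y = VectorField.lieBracket ℝ (E := E) X Y := by
  rw [← VectorField.mlieBracketWithin_univ]
  exact VectorField.mlieBracketWithin_eq_lieBracketWithin.trans VectorField.lieBracketWithin_univ

/-- The pull-back of a connection form under a map from a vector space. -/
def pullbackForm (A : ∀ p : P, TangentSpace IP p →L[ℝ] GroupLieAlgebra IG G) (Ψ : E → P) (z : E) :
    E →L[ℝ] EG :=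
  (A (Ψ z)).comp (mfderiv 𝓘(ℝ, E) IP Ψ z)

variable [IsManifold IP ∞ P]

/-- In finite dimension it suffices to evaluate on a constant vector `u`. The result is the smooth
function `A` on the tangent bundle, composed with the tangent map of `Ψ` and the constant field `u`.
-/
theorem contDiffOn_pullbackForm [MulAction Gᵐᵒᵖ P] [FiniteDimensional ℝ E]
    {A : ∀ p : P, TangentSpace IP p →L[ℝ] GroupLieAlgebra IG G} (hA : IsConnection IG IP A)
    {Ψ : E → P} {Ω : Set E} (hΩ : IsOpen Ω) (hΨ : ContMDiffOn 𝓘(ℝ, E) IP ∞ Ψ Ω) :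
    ContDiffOn ℝ ∞ (pullbackForm A Ψ) Ω := by
  have : IsManifold IP 1 P := IsManifold.of_le (n := ∞) (by simp)
  refine contDiffOn_clm_apply.2 fun u => ?_
  rw [← contMDiffOn_iff_contDiffOn]
  have h1 := hΨ.contMDiffOn_tangentMapWithin (m := ∞) (by simp) hΩ.uniqueMDiffOn
  have h2 : ContMDiffOn 𝓘(ℝ, E) 𝓘(ℝ, E).tangent ∞
      (fun z => (⟨z, u⟩ : TangentBundle 𝓘(ℝ, E) E)) Ω :=
    contMDiffOn_vectorSpace_iff_contDiffOn.2 contDiffOn_const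
  have h3 := (hA.smooth.comp_contMDiffOn h1).comp h2 fun z hz => hz
  refine h3.congr fun z hz => ?_
  exact congrArg (fun L : E →L[ℝ] EP => A (Ψ z) (L u)) (mfderivWithin_of_isOpen hΩ hz).symm

/-- In local coordinates, the kernel of a flat connection form is closed under Lie brackets. -/
theorem IsFlat.pullbackForm_lieBracket [CompleteSpace E] [CompleteSpace EP]
    {A : ∀ p : P, TangentSpace IP p →L[ℝ] GroupLieAlgebra IG G} (hA : IsFlat IG IP A)
    {Ψ : E → P} {Θ : P → E} {Ω : Set E} {O : Set P} (hΩ : IsOpen Ω) (hO : IsOpen O)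
    (hΨ : ContMDiffOn 𝓘(ℝ, E) IP ∞ Ψ Ω) (hΘ : ContMDiffOn IP 𝓘(ℝ, E) ∞ Θ O)
    (hΨO : ∀ z ∈ Ω, Ψ z ∈ O) (hΘΩ : ∀ p ∈ O, Θ p ∈ Ω) (hΘΨ : ∀ z ∈ Ω, Θ (Ψ z) = z)
    (hΨΘ : ∀ p ∈ O, Ψ (Θ p) = p) {X Y : E → E} (hX : ContDiffOn ℝ ∞ X Ω)
    (hY : ContDiffOn ℝ ∞ Y Ω) (hX0 : ∀ z ∈ Ω, pullbackForm A Ψ z (X z) = 0)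
    (hY0 : ∀ z ∈ Ω, pullbackForm A Ψ z (Y z) = 0) {z : E} (hz : z ∈ Ω) :
    pullbackForm A Ψ z (VectorField.lieBracket ℝ X Y z) = 0 := by
  have : IsManifold IP 1 P := IsManifold.of_le (n := ∞) (by simp)
  have : IsManifold IP (minSmoothness ℝ 3) P := IsManifold.of_le (n := ∞) (by
    rw [minSmoothness_of_isRCLikeNormedField]; exact ENat.LEInfty.out)
  have hΨd : ∀ z ∈ Ω, MDifferentiableAt 𝓘(ℝ, E) IP Ψ z := fun z hz =>
    (hΨ.contMDiffAt (hΩ.mem_nhds hz)).mdifferentiableAt (by simp)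
  have hΘd : ∀ z ∈ Ω, MDifferentiableAt IP 𝓘(ℝ, E) Θ (Ψ z) := fun z hz =>
    (hΘ.contMDiffAt (hO.mem_nhds (hΨO z hz))).mdifferentiableAt (by simp)
  -- The derivatives of `Θ` and `Ψ` are mutually inverse, so pulling a vector field back along `Θ`
  -- is the same as pushing it forward along `Ψ`. This turns fields in coordinates into fields on
  -- `O`.
  have c1 : ∀ z ∈ Ω, (mfderiv IP 𝓘(ℝ, E) Θ (Ψ z) : EP →L[ℝ] E) ∘L
      (mfderiv 𝓘(ℝ, E) IP Ψ z : E →L[ℝ] EP) = .id ℝ E := by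
    intro z hz
    have h1 := mfderiv_comp z (hΘd z hz) (hΨd z hz)
    have h2 : Θ ∘ Ψ =ᶠ[𝓝 z] id := by
      filter_upwards [hΩ.mem_nhds hz] with z' hz' using hΘΨ z' hz'
    rw [h2.mfderiv_eq, mfderiv_id] at h1
    exact h1.symm
  have c2 : ∀ z ∈ Ω, (mfderiv 𝓘(ℝ, E) IP Ψ z : E →L[ℝ] EP) ∘L
      (mfderiv IP 𝓘(ℝ, E) Θ (Ψ z) : EP →L[ℝ] E) = .id ℝ EP := by
    intro z hz
    have hd : MDifferentiableAt 𝓘(ℝ, E) IP Ψ (Θ (Ψ z)) := by rw [hΘΨ z hz]; exact hΨd z hz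
    have h1 := mfderiv_comp (Ψ z) hd (hΘd z hz)
    have h2 : Ψ ∘ Θ =ᶠ[𝓝 (Ψ z)] id := by
      filter_upwards [hO.mem_nhds (hΨO z hz)] with p hp using hΨΘ p hp
    rw [h2.mfderiv_eq, mfderiv_id] at h1
    have h3 : (mfderiv 𝓘(ℝ, E) IP Ψ (Θ (Ψ z)) : E →L[ℝ] EP) = mfderiv 𝓘(ℝ, E) IP Ψ z := by
      rw [hΘΨ z hz]
    have h4 : (mfderiv 𝓘(ℝ, E) IP Ψ (Θ (Ψ z)) : E →L[ℝ] EP) ∘L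
      (mfderiv IP 𝓘(ℝ, E) Θ (Ψ z) : EP →L[ℝ] E) = .id ℝ EP := h1.symm
    rwa [h3] at h4
  have hinv : ∀ z ∈ Ω, (mfderiv IP 𝓘(ℝ, E) Θ (Ψ z)).inverse =
      (mfderiv 𝓘(ℝ, E) IP Ψ z : E →L[ℝ] EP) := fun z hz =>
    ContinuousLinearMap.inverse_eq (c1 z hz) (c2 z hz)
  have hinv' : ∀ z ∈ Ω, (mfderiv IP 𝓘(ℝ, E) Θ (Ψ z)).IsInvertible := fun z hz =>
    ⟨ContinuousLinearEquiv.equivOfInverse'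
      (mfderiv IP 𝓘(ℝ, E) Θ (Ψ z) : EP →L[ℝ] E) (mfderiv 𝓘(ℝ, E) IP Ψ z : E →L[ℝ] EP)
      (c1 z hz) (c2 z hz), rfl⟩
  have happ : ∀ (V : E → E), ∀ z ∈ Ω,
      A (Ψ z) (VectorField.mpullback IP 𝓘(ℝ, E) Θ V (Ψ z)) = pullbackForm A Ψ z (V z) := by
    intro V z hz
    have h1 : (VectorField.mpullback IP 𝓘(ℝ, E) Θ V (Ψ z) : EP) =
        (mfderiv 𝓘(ℝ, E) IP Ψ z : E →L[ℝ] EP) (V z) := by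
      change (mfderiv IP 𝓘(ℝ, E) Θ (Ψ z)).inverse (V (Θ (Ψ z))) = _
      rw [hΘΨ z hz]
      exact congrArg (fun L : E →L[ℝ] EP => L (V z)) (hinv z hz)
    exact congrArg (A (Ψ z)) h1
  have hsm : ∀ {V : E → E}, ContDiffOn ℝ ∞ V Ω → ContMDiffOn IP IP.tangent ∞
      (fun p => (⟨p, VectorField.mpullback IP 𝓘(ℝ, E) Θ V p⟩ : TangentBundle IP P)) O := by
    intro V hV p hp
    have hp' := hΨΘ p hp
    have h1 : ContMDiffAt 𝓘(ℝ, E) 𝓘(ℝ, E).tangent ∞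
        (fun z => (⟨z, V z⟩ : TangentBundle 𝓘(ℝ, E) E)) (Θ p) :=
      contMDiffAt_vectorSpace_iff_contDiffAt.2 (hV.contDiffAt (hΩ.mem_nhds (hΘΩ p hp)))
    have h2 := hinv' _ (hΘΩ p hp)
    rw [hp'] at h2
    exact (h1.mpullback_vectorField_preimage (hΘ.contMDiffAt (hO.mem_nhds hp)) h2
      (by simp)).contMDiffWithinAt
  have hz0 : ∀ {V : E → E}, (∀ z ∈ Ω, pullbackForm A Ψ z (V z) = 0) →
      ∀ p ∈ O, A p (VectorField.mpullback IP 𝓘(ℝ, E) Θ V p) = 0 := by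
    intro V hV p hp
    have h1 := happ V _ (hΘΩ p hp)
    rw [hV _ (hΘΩ p hp), hΨΘ p hp] at h1
    exact h1
  have hfl := hA O _ _ hO (hsm hX) (hsm hY) (hz0 hX0) (hz0 hY0) (Ψ z) (hΨO z hz)
  have hdiff : ∀ {V : E → E}, ContDiffOn ℝ ∞ V Ω → MDifferentiableAt 𝓘(ℝ, E) 𝓘(ℝ, E).tangent
      (fun z => (⟨z, V z⟩ : TangentBundle 𝓘(ℝ, E) E)) (Θ (Ψ z)) := by
    intro V hV
    rw [hΘΨ z hz]
    exact (contMDiffAt_vectorSpace_iff_contDiffAt.2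
      (hV.contDiffAt (hΩ.mem_nhds hz))).mdifferentiableAt (by simp)
  -- Brackets are natural under pull-back, so the conclusion `hfl` on `P` is the desired one in
  -- coordinates.
  have hb := VectorField.mpullback_mlieBracket (hdiff hX) (hdiff hY)
    (hΘ.contMDiffAt (hO.mem_nhds (hΨO z hz))) (n := ∞) (by
      rw [minSmoothness_of_isRCLikeNormedField]; exact ENat.LEInfty.out)
  have h3 := (happ (VectorField.mlieBracket 𝓘(ℝ, E) X Y) z hz).symm.trans
    ((congrArg (A (Ψ z)) hb).trans hfl)
  exact (congrArg (fun V : E → E => pullbackForm A Ψ z (V z))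
    mlieBracket_eq_lieBracket).symm.trans h3

variable (IM) in
/-- `s` is a smooth horizontal section over `U`. -/
structure IsHorizontalSectionOn (π : P → M)
    (A : ∀ p : P, TangentSpace IP p →L[ℝ] GroupLieAlgebra IG G) (s : M → P) (U : Set M) :
    Prop where
  smooth : ContMDiffOn IM IP ∞ s U
  proj : ∀ x ∈ U, π (s x) = x
  horizontal : ∀ x ∈ U, ∀ u : TangentSpace IM x, A (s x) (mfderiv IM IP s x u) = 0

end Flat

/-! ### Integration of the horizontal distribution -/

section LocalSection

open Set Filter Topology

variable {EM HM EG HG EP HP M G P : Type*}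
  [NormedAddCommGroup EM] [NormedSpace ℝ EM] [TopologicalSpace HM]
  [NormedAddCommGroup EG] [NormedSpace ℝ EG] [TopologicalSpace HG]
  [NormedAddCommGroup EP] [NormedSpace ℝ EP] [TopologicalSpace HP]
  {IM : ModelWithCorners ℝ EM HM} {IG : ModelWithCorners ℝ EG HG} {IP : ModelWithCorners ℝ EP HP}
  [TopologicalSpace M] [ChartedSpace HM M]
  [TopologicalSpace G] [ChartedSpace HG G] [Group G] [LieGroup IG ∞ G]
  [TopologicalSpace P] [ChartedSpace HP P] [IsManifold IP ∞ P] [MulAction Gᵐᵒᵖ P] {π : P → M}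

theorem isInvertible_of_injective {F : Type*} [NormedAddCommGroup F] [NormedSpace ℝ F]
    [FiniteDimensional ℝ F] {L : F →L[ℝ] F} (hL : ∀ w, L w = 0 → w = 0) : L.IsInvertible :=
  ⟨(LinearEquiv.ofInjectiveEndo (L : F →ₗ[ℝ] F)
    ((injective_iff_map_eq_zero _).2 hL)).toContinuousLinearEquiv, by ext; rfl⟩

/-- The vertical part of a connection form in coordinates is invertible. -/
theorem IsConnection.isInvertible_pullbackForm_comp_inr [FiniteDimensional ℝ EG]
    [IG.Boundaryless]
    (hP : IsPrincipalBundle (G := G) IM IG IP π)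
    {A : ∀ p : P, TangentSpace IP p →L[ℝ] GroupLieAlgebra IG G} (hA : IsConnection IG IP A)
    {σ : EM → P} {g₀ : G} {z : EM × EG} (hσ : MDifferentiableAt 𝓘(ℝ, EM) IP σ z.1)
    (hz : z.2 ∈ (extChartAt IG g₀).target) :
    (pullbackForm A (fun z : EM × EG => op ((extChartAt IG g₀).symm z.2) • σ z.1) z ∘L
      ContinuousLinearMap.inr ℝ EM EG).IsInvertible := by
  have : IsManifold IG 1 G := IsManifold.of_le (n := ∞) (by simp)
  set c := extChartAt IG g₀
  have hc : MDifferentiableAt 𝓘(ℝ, EG) IG c.symm z.2 :=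
    ((contMDiffOn_extChartAt_symm (n := 1) g₀).contMDiffAt
      ((isOpen_extChartAt_target g₀).mem_nhds hz)).mdifferentiableAt (by simp)
  have h1 : HasMFDerivAt 𝓘(ℝ, EM × EG) IP (fun z : EM × EG => σ z.1) z
      ((mfderiv 𝓘(ℝ, EM) IP σ z.1).comp (ContinuousLinearMap.fst ℝ EM EG)) :=
    HasMFDerivAt.comp z (f := Prod.fst) hσ.hasMFDerivAt
      (ContinuousLinearMap.fst ℝ EM EG).hasMFDerivAt
  have h2 : HasMFDerivAt 𝓘(ℝ, EM × EG) IG (fun z : EM × EG => c.symm z.2) z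
      ((mfderiv 𝓘(ℝ, EG) IG c.symm z.2).comp (ContinuousLinearMap.snd ℝ EM EG)) :=
    HasMFDerivAt.comp z (f := Prod.snd) hc.hasMFDerivAt
      (ContinuousLinearMap.snd ℝ EM EG).hasMFDerivAt
  refine isInvertible_of_injective fun w hw => ?_
  -- In a vertical direction `(0, w)` the first term of the product rule vanishes; what is left is
  -- the Maurer-Cartan form after the derivative of an inverse chart, both injective.
  have h3 := hA.apply_mfderiv_act hP h1.mdifferentiableAt h2.mdifferentiableAt
    ((0 : EM), w)
  rw [h1.mfderiv, h2.mfderiv] at h3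
  have h4 : ((mfderiv 𝓘(ℝ, EM) IP σ z.1).comp (ContinuousLinearMap.fst ℝ EM EG)) ((0 : EM), w)
    = (0 : EP) := map_zero (mfderiv 𝓘(ℝ, EM) IP σ z.1)
  have h5 : adjointAction IG (c.symm z.2)⁻¹ (A (σ z.1)
      (((mfderiv 𝓘(ℝ, EM) IP σ z.1).comp (ContinuousLinearMap.fst ℝ EM EG)) ((0 : EM), w))) =
      (0 : EG) := by
    refine Eq.trans ?_ (adjointAction_zero (IG := IG) (c.symm z.2)⁻¹)
    exact congrArg (adjointAction IG (c.symm z.2)⁻¹)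
      ((congrArg (A (σ z.1)) h4).trans (map_zero (A (σ z.1))))
  have h6 : maurerCartan IG (c.symm z.2) (mfderiv 𝓘(ℝ, EG) IG c.symm z.2 w) = (0 : EG) := by
    have h7 := h3.symm.trans hw
    exact (zero_add _).symm.trans ((congrArg (· + _) h5).symm.trans h7)
  have h8 := maurerCartan_injective _ h6
  have h9 := isInvertible_mfderivWithin_extChartAt_symm (I := IG) hz
  rw [IG.range_eq_univ, mfderivWithin_univ] at h9
  obtain ⟨L, hL⟩ := h9
  have h10 : L w = 0 := (congrArg (fun L : EG →L[ℝ] EG => L w) hL).trans h8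
  exact L.map_eq_zero_iff.1 h10

/-- A flat connection has horizontal sections through every fibre. -/
theorem exists_isHorizontalSectionOn [IsManifold IM ∞ M]
    [FiniteDimensional ℝ EM] [FiniteDimensional ℝ EG]
    [FiniteDimensional ℝ EP] [IM.Boundaryless] [IG.Boundaryless]
    (hP : IsPrincipalBundle (G := G) IM IG IP π)
    {A : ∀ p : P, TangentSpace IP p →L[ℝ] GroupLieAlgebra IG G} (hA : IsConnection IG IP A)
    (hflat : IsFlat IG IP A) (x₀ : M) :
    ∃ U : Set M, IsOpen U ∧ x₀ ∈ U ∧ ∃ s : M → P, IsHorizontalSectionOn IM π A s U := by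
  have : CompleteSpace EP := FiniteDimensional.complete ℝ EP
  have : CompleteSpace EM := FiniteDimensional.complete ℝ EM
  have : CompleteSpace EG := FiniteDimensional.complete ℝ EG
  have : IsManifold IM 1 M := IsManifold.of_le (n := ∞) (by simp)
  obtain ⟨e, hx₀, he1, he2, he⟩ := hP.locally_trivial x₀
  set χ := extChartAt IM x₀
  set c := extChartAt IG (1 : G)
  set Ω : Set (EM × EG) := (χ.target ∩ χ.symm ⁻¹' e.baseSet) ×ˢ c.target with hΩdef
  have hΩ1 : IsOpen (χ.target ∩ χ.symm ⁻¹' e.baseSet) :=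
    (continuousOn_extChartAt_symm x₀).isOpen_inter_preimage (isOpen_extChartAt_target x₀)
      e.open_baseSet
  have hΩ : IsOpen Ω := hΩ1.prod (isOpen_extChartAt_target _)
  -- The unit section of the trivialization. Translating it by group elements written in the chart
  -- `c` yields coordinates `Ψ` on `P`, with inverse `Θ`, in which the second factor is the fibre
  -- direction.
  set s₀ : M → P := fun x => e.toOpenPartialHomeomorph.symm (x, 1) with hs₀
  have hs₀s : ContMDiffOn IM IP ∞ s₀ e.baseSet :=
    he2.comp (contMDiffOn_id.prodMk contMDiffOn_const) fun x hx => e.mem_target.2 hx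
  have hs₀p : ∀ x ∈ e.baseSet, π (s₀ x) = x := fun x hx => e.proj_symm_apply' hx
  have hes₀ : ∀ x ∈ e.baseSet, (e (s₀ x)).2 = 1 := fun x hx =>
    congrArg Prod.snd (e.apply_symm_apply' hx (x := (1 : G)))
  set σ : EM → P := fun x => s₀ (χ.symm x) with hσ
  have hχs : ContMDiffOn 𝓘(ℝ, EM) IM ∞ χ.symm χ.target := contMDiffOn_extChartAt_symm x₀
  have hcs : ContMDiffOn 𝓘(ℝ, EG) IG ∞ c.symm c.target := contMDiffOn_extChartAt_symm 1
  have hχ : ContMDiffOn IM 𝓘(ℝ, EM) ∞ χ χ.source := by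
    rw [extChartAt_source]; exact contMDiffOn_extChartAt
  have hc : ContMDiffOn IG 𝓘(ℝ, EG) ∞ c c.source := by
    rw [extChartAt_source]; exact contMDiffOn_extChartAt
  have hσs : ContMDiffOn 𝓘(ℝ, EM) IP ∞ σ (χ.target ∩ χ.symm ⁻¹' e.baseSet) :=
    hs₀s.comp (hχs.mono inter_subset_left) fun x hx => hx.2
  set Ψ : EM × EG → P := fun z => op (c.symm z.2) • σ z.1 with hΨ
  set Θ : P → EM × EG := fun p => (χ (π p), c (e p).2) with hΘ
  set O : Set P := (e.source ∩ (fun p => (e p).2) ⁻¹' c.source) ∩ π ⁻¹' χ.source with hO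
  have hOo : IsOpen O := by
    have h1 : ContinuousOn (fun p => (e p).2) e.source := he1.continuousOn.snd
    exact (h1.isOpen_inter_preimage e.open_source (isOpen_extChartAt_source 1)).inter
      ((isOpen_extChartAt_source x₀).preimage hP.contMDiff_proj.continuous)
  have hΨs : ContMDiffOn 𝓘(ℝ, EM × EG) IP ∞ Ψ Ω := by
    intro z hz
    refine (hP.contMDiffAt_act ?_ ?_).contMDiffWithinAt
    · exact (hσs.contMDiffAt (hΩ1.mem_nhds hz.1)).comp z contDiff_fst.contMDiff.contMDiffAt
    · exact (hcs.contMDiffAt ((isOpen_extChartAt_target _).mem_nhds hz.2)).comp z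
        contDiff_snd.contMDiff.contMDiffAt
  have hΘs : ContMDiffOn IP 𝓘(ℝ, EM × EG) ∞ Θ O := by
    refine ContMDiffOn.prodMk_space ?_ ?_
    · exact hχ.comp hP.contMDiff_proj.contMDiffOn fun p hp => hp.2
    · have h1 : ContMDiffOn IP IG ∞ (fun p => (e p).2) O := fun p hp =>
        (he1.mono (fun q hq => hq.1.1 : O ⊆ e.source) p hp).snd
      exact hc.comp h1 fun p hp => hp.1.2
  have hπΨ : ∀ z ∈ Ω, π (Ψ z) = χ.symm z.1 := fun z hz => by
    simp only [hΨ]; rw [hP.proj_act]; exact hs₀p _ hz.1.2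
  have heΨ : ∀ z ∈ Ω, (e (Ψ z)).2 = c.symm z.2 := fun z hz => by
    simp only [hΨ, hσ]
    rw [he _ (e.mem_source.2 (by rw [hs₀p _ hz.1.2]; exact hz.1.2)), hes₀ _ hz.1.2, one_mul]
  have hΨO : ∀ z ∈ Ω, Ψ z ∈ O := fun z hz => by
    refine ⟨⟨e.mem_source.2 ?_, ?_⟩, ?_⟩
    · rw [hπΨ z hz]; exact hz.1.2
    · rw [mem_preimage, heΨ z hz]; exact c.map_target hz.2
    · rw [mem_preimage, hπΨ z hz]; exact χ.map_target hz.1.1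
  have hΘΩ : ∀ p ∈ O, Θ p ∈ Ω := fun p hp => by
    refine ⟨⟨χ.map_source hp.2, ?_⟩, c.map_source hp.1.2⟩
    simp only [hΘ, mem_preimage, χ.left_inv hp.2]
    exact e.mem_source.1 hp.1.1
  have hΘΨ : ∀ z ∈ Ω, Θ (Ψ z) = z := fun z hz => by
    simp only [hΘ]
    rw [hπΨ z hz, heΨ z hz, χ.right_inv hz.1.1, c.right_inv hz.2]
  have hΨΘ : ∀ p ∈ O, Ψ (Θ p) = p := fun p hp => by
    have hb := e.mem_source.1 hp.1.1
    have h1 := hP.act_translation_of_trivialization (p := s₀ (π p)) (q := p) he (hs₀p _ hb)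
      (by rw [hs₀p _ hb]; exact hb)
    rw [hes₀ _ hb, inv_one, one_mul] at h1
    simp only [hΨ, hΘ, hσ, χ.left_inv hp.2, c.left_inv hp.1.2]
    exact h1
  -- The integral graph `y` is the horizontal section in these coordinates.
  obtain ⟨U, hU, hxU, y, -, hys, hy⟩ := exists_integral_graph (x₀ := χ x₀) (y₀ := c 1) hΩ
    (contDiffOn_pullbackForm hA hΩ hΨs)
    (fun z hz => hA.isInvertible_pullbackForm_comp_inr hP
      ((hσs.contMDiffAt (hΩ1.mem_nhds hz.1)).mdifferentiableAt (by simp)) hz.2)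
    (fun X Y hX hY hX0 hY0 z hz => hflat.pullbackForm_lieBracket hΩ hOo hΨs hΘs hΨO hΘΩ hΘΨ hΨΘ
      hX hY hX0 hY0 hz)
    ⟨⟨mem_extChartAt_target x₀, by
      rw [mem_preimage, extChartAt_to_inv x₀]; exact hx₀⟩, mem_extChartAt_target 1⟩
  have hgs : ContMDiffOn 𝓘(ℝ, EM) 𝓘(ℝ, EM × EG) ∞ (fun x => (x, y x)) U :=
    (contDiffOn_id.prodMk hys).contMDiffOn
  refine ⟨χ.source ∩ χ ⁻¹' U, isOpen_extChartAt_preimage' x₀ hU,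
    ⟨mem_extChartAt_source x₀, hxU⟩, fun x => Ψ (χ x, y (χ x)), ?_, ?_, ?_⟩
  · exact hΨs.comp (hgs.comp (hχ.mono inter_subset_left) fun x hx => hx.2)
      fun x hx => (hy _ hx.2).1
  · intro x hx
    rw [hπΨ _ (hy _ hx.2).1]
    exact χ.left_inv hx.1
  · intro x hx u
    obtain ⟨hm, h0⟩ := hy _ hx.2
    have d1 : MDifferentiableAt IM 𝓘(ℝ, EM) χ x :=
      mdifferentiableAt_extChartAt (by have := hx.1; rwa [extChartAt_source] at this)
    have d2 : HasMFDerivAt 𝓘(ℝ, EM) 𝓘(ℝ, EM × EG) (fun x => (x, y x)) (χ x)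
        ((ContinuousLinearMap.id ℝ EM).prod (fderiv ℝ y (χ x))) :=
      ((hasFDerivAt_id _).prodMk ((hys.contDiffAt (hU.mem_nhds hx.2)).differentiableAt
        (by simp)).hasFDerivAt).hasMFDerivAt
    have d3 : MDifferentiableAt 𝓘(ℝ, EM × EG) IP Ψ (χ x, y (χ x)) :=
      (hΨs.contMDiffAt (hΩ.mem_nhds hm)).mdifferentiableAt (by simp)
    have d4 := HasMFDerivAt.comp x (f := (fun x => (x, y x)) ∘ χ) d3.hasMFDerivAt
      (d2.comp x d1.hasMFDerivAt)
    have d5 := d4.mfderiv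
    exact (congrArg (fun L : EM →L[ℝ] EP => A (Ψ (χ x, y (χ x))) (L u)) d5).trans
      (h0 (mfderiv IM 𝓘(ℝ, EM) χ x u))

end LocalSection

/-! ### Global horizontal sections over a simply connected base -/

open Set Filter Topology in
/-- A locally constant cocycle on a simply connected space is a coboundary. -/
theorem exists_splitting_of_locally_constant_cocycle {M ι Γ : Type*} [TopologicalSpace M]
    [SimplyConnectedSpace M] [LocallyPathConnectedSpace M] [Group Γ] {U : ι → Set M}
    (hU : ∀ i, IsOpen (U i)) (hcov : ∀ x, ∃ i, x ∈ U i) {g : ι → ι → M → Γ}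
    (hmul : ∀ i j k, ∀ x ∈ U i ∩ U j ∩ U k, g i j x * g j k x = g i k x)
    (hloc : ∀ i j, ∀ x ∈ U i ∩ U j, ∀ᶠ y in 𝓝 x, g i j y = g i j x) :
    ∃ h : ι → M → Γ, (∀ i, ∀ x ∈ U i, ∀ᶠ y in 𝓝 x, h i y = h i x) ∧
      ∀ i j, ∀ x ∈ U i ∩ U j, g i j x * h j x = h i x := by
  -- With the discrete topology on `Γ`, a locally constant cocycle is a continuous one, and the
  -- bundle it defines is a covering space.
  let _ : TopologicalSpace Γ := ⊥
  have : DiscreteTopology Γ := ⟨rfl⟩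
  choose idx hidx using hcov
  let Z : FiberBundleCore ι M Γ :=
    { baseSet := U
      isOpen_baseSet := hU
      indexAt := idx
      mem_baseSet_at := hidx
      -- The indices are swapped: passing from coordinate `i` to coordinate `j` multiplies by `g j
      -- i`, which is what makes the coordinates `h` of a section satisfy `g i j * h j = h i`.
      coordChange := fun i j x v => g j i x * v
      coordChange_self := fun i x hx v => by
        have := hmul i i i x ⟨⟨hx, hx⟩, hx⟩
        rw [mul_eq_left.1 this, one_mul]
      continuousOn_coordChange := fun i j p hp => by
        refine ContinuousAt.continuousWithinAt ?_
        have h1 : ∀ᶠ q : M × Γ in 𝓝 p, g j i q.1 = g j i p.1 :=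
          continuousAt_fst.eventually (hloc j i p.1 hp.1.symm)
        have h2 : ContinuousAt (fun q : M × Γ => g j i p.1 * q.2) p := by
          have : Continuous fun v : Γ => g j i p.1 * v := continuous_of_discreteTopology
          exact (this.comp continuous_snd).continuousAt
        refine h2.congr ?_
        filter_upwards [h1] with q hq
        rw [hq]
      coordChange_comp := fun i j k x hx v => by
        rw [← mul_assoc, hmul k j i x ⟨⟨hx.2, hx.1.2⟩, hx.1.1⟩] }
  have cov : IsCoveringMap (Bundle.TotalSpace.proj : Z.TotalSpace → M) :=
    FiberBundle.isCoveringMap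
  obtain ⟨x₀⟩ : Nonempty M := inferInstance
  -- A lift of the identity of `M` is a global section. Its local coordinates are continuous with
  -- discrete values, hence locally constant, and they split the cocycle.
  obtain ⟨F, ⟨-, hF⟩, -⟩ := cov.existsUnique_continuousMap_lifts (ContinuousMap.id M) x₀
    (⟨x₀, (1 : Γ)⟩ : Z.TotalSpace) rfl
  have hF' : ∀ x, (F x).proj = x := fun x => congrFun hF x
  refine ⟨fun i x => (Z.localTriv i (F x)).2, fun i x hx => ?_, fun i j x hx => ?_⟩
  · have h1 : F x ∈ (Z.localTriv i).source := by
      rw [FiberBundleCore.mem_localTriv_source, hF' x]; exact hx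
    have h2 : ContinuousAt (fun y => (Z.localTriv i (F y)).2) x :=
      continuousAt_snd.comp (((Z.localTriv i).continuousAt h1).comp F.continuous.continuousAt)
    exact h2.preimage_mem_nhds ((isOpen_discrete {(Z.localTriv i (F x)).2}).mem_nhds rfl)
  · have h1 := Z.coordChange_comp (idx x) j i x ⟨⟨hidx x, hx.2⟩, hx.1⟩
    simp only [FiberBundleCore.localTriv_apply]
    have h2 : (F x).1 = x := hF' x
    generalize F x = q at h2
    obtain ⟨b, v⟩ := q
    obtain rfl : b = x := h2
    exact h1 v

/-! ### Gluing local horizontal sections -/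

section GlobalSection

open Set Filter Topology

variable {EM HM EG HG EP HP M G P : Type*}
  [NormedAddCommGroup EM] [NormedSpace ℝ EM] [TopologicalSpace HM]
  [NormedAddCommGroup EG] [NormedSpace ℝ EG] [TopologicalSpace HG]
  [NormedAddCommGroup EP] [NormedSpace ℝ EP] [TopologicalSpace HP]
  {IM : ModelWithCorners ℝ EM HM} {IG : ModelWithCorners ℝ EG HG} {IP : ModelWithCorners ℝ EP HP}
  [TopologicalSpace M] [ChartedSpace HM M]
  [TopologicalSpace G] [ChartedSpace HG G] [Group G] [LieGroup IG ∞ G]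
  [TopologicalSpace P] [ChartedSpace HP P] [IsManifold IP ∞ P] [MulAction Gᵐᵒᵖ P] {π : P → M}
  {A : ∀ p : P, TangentSpace IP p →L[ℝ] GroupLieAlgebra IG G}

/-- Two horizontal sections differ by a locally constant map to the structure group. -/
theorem IsHorizontalSectionOn.eventually_translation_eq [IsManifold IM ∞ M] [IM.Boundaryless]
    (hP : IsPrincipalBundle (G := G) IM IG IP π) (hA : IsConnection IG IP A)
    {s t : M → P} {U V : Set M} (hU : IsOpen U) (hV : IsOpen V)
    (hs : IsHorizontalSectionOn IM π A s U) (ht : IsHorizontalSectionOn IM π A t V) {x : M}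
    (hx : x ∈ U ∩ V) :
    ∀ᶠ y in 𝓝 x, translation G (s y) (t y) = translation G (s x) (t x) := by
  have : IsManifold IM 1 M := IsManifold.of_le (n := ∞) (by simp)
  have : IsManifold IG 1 G := IsManifold.of_le (n := ∞) (by simp)
  have hUV := hU.inter hV
  have hst : ∀ y ∈ U ∩ V, π (s y) = π (t y) := fun y hy =>
    (hs.proj y hy.1).trans (ht.proj y hy.2).symm
  refine eventually_eq_of_mfderiv_eq_zero (IM := IM) (IN := IG)
    (f := fun y => translation G (s y) (t y)) ?_
  filter_upwards [hUV.mem_nhds hx] with y hy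
  have hsy : ContMDiffAt IM IP ∞ s y := hs.smooth.contMDiffAt (hU.mem_nhds hy.1)
  have hty : ContMDiffAt IM IP ∞ t y := ht.smooth.contMDiffAt (hV.mem_nhds hy.2)
  have hg := (hP.contMDiffAt_translation hsy hty (by
    filter_upwards [hUV.mem_nhds hy] with z hz using hst z hz)).mdifferentiableAt (by simp)
  refine ⟨hg, ?_⟩
  ext u
  -- The product rule for `t = s · g`: since `s` and `t` are both horizontal, only the Maurer-Cartan
  -- form of the derivative of `g` survives, and it must vanish.
  have h1 := hA.apply_mfderiv_act hP (hsy.mdifferentiableAt (by simp)) hg u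
  have h2 : (fun z => op (translation G (s z) (t z)) • s z) =ᶠ[𝓝 y] t := by
    filter_upwards [hUV.mem_nhds hy] with z hz using hP.act_translation (hst z hz)
  rw [hs.horizontal y hy.1, adjointAction_zero, zero_add, h2.mfderiv_eq,
    hP.act_translation (hst y hy)] at h1
  exact maurerCartan_injective _ (h1.symm.trans (ht.horizontal y hy.2 u))

theorem IsHorizontalSectionOn.act (hP : IsPrincipalBundle (G := G) IM IG IP π)
    (hA : IsConnection IG IP A) {s : M → P} {U : Set M} (hU : IsOpen U)
    (hs : IsHorizontalSectionOn IM π A s U) (g : G) :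
    IsHorizontalSectionOn IM π A (fun x => op g • s x) U := by
  have hsx : ∀ x ∈ U, ContMDiffAt IM IP ∞ s x := fun x hx =>
    hs.smooth.contMDiffAt (hU.mem_nhds hx)
  refine ⟨fun x hx => (hP.contMDiffAt_act (hsx x hx) contMDiffAt_const).contMDiffWithinAt,
    fun x hx => by rw [hP.proj_act, hs.proj x hx], fun x hx u => ?_⟩
  have h1 := hA.apply_mfderiv_act hP ((hsx x hx).mdifferentiableAt (by simp))
    (mdifferentiableAt_const (I' := IG) (c := g)) u
  rw [hs.horizontal x hx, adjointAction_zero, zero_add, mfderiv_const] at h1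
  exact h1.trans (map_zero (maurerCartan IG g))

omit [LieGroup IG ∞ G] [IsManifold IP ∞ P] [MulAction Gᵐᵒᵖ P] in
theorem IsHorizontalSectionOn.of_eventuallyEq {s : M → P}
    (h : ∀ x, ∃ (t : M → P) (U : Set M), IsOpen U ∧ x ∈ U ∧ IsHorizontalSectionOn IM π A t U ∧
      s =ᶠ[𝓝 x] t) : IsHorizontalSectionOn IM π A s univ := by
  refine ⟨fun x _ => ?_, fun x _ => ?_, fun x _ u => ?_⟩ <;>
    obtain ⟨t, U, hU, hx, ht, hst⟩ := h x
  · exact ((ht.smooth.contMDiffAt (hU.mem_nhds hx)).congr_of_eventuallyEq hst).contMDiffWithinAt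
  · rw [hst.eq_of_nhds]; exact ht.proj x hx
  · rw [hst.mfderiv_eq, hst.eq_of_nhds]; exact ht.horizontal x hx u

/-- A flat connection over a simply connected manifold has a global horizontal section. -/
theorem exists_isHorizontalSectionOn_univ [IsManifold IM ∞ M] [SimplyConnectedSpace M]
    [FiniteDimensional ℝ EM] [FiniteDimensional ℝ EG]
    [FiniteDimensional ℝ EP] [IM.Boundaryless] [IG.Boundaryless]
    (hP : IsPrincipalBundle (G := G) IM IG IP π) (hA : IsConnection IG IP A)
    (hflat : IsFlat IG IP A) :
    ∃ s : M → P, IsHorizontalSectionOn IM π A s univ := by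
  have : LocallyPathConnectedSpace HM :=
    IM.toHomeomorph.isOpenEmbedding.locallyPathConnectedSpace
  have : LocallyPathConnectedSpace M := ChartedSpace.locallyPathConnectedSpace HM M
  choose U hU hxU s hs using exists_isHorizontalSectionOn (IM := IM) hP hA hflat
  have hpr : ∀ i j x, x ∈ U i ∩ U j → π (s i x) = π (s j x) := fun i j x hx =>
    ((hs i).proj x hx.1).trans ((hs j).proj x hx.2).symm
  obtain ⟨h, hloc, hg⟩ := exists_splitting_of_locally_constant_cocycle hU (fun x => ⟨x, hxU x⟩)
    (g := fun i j x => translation G (s i x) (s j x))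
    (fun i j k x hx => hP.translation_mul (hpr i j x hx.1) (hpr j k x ⟨hx.1.2, hx.2⟩))
    (fun i j x hx => (hs i).eventually_translation_eq hP hA (hU i) (hU j) (hs j) hx)
  -- The sections `s i · h i` agree on overlaps, so the diagonal choice of index is harmless: near
  -- `i` it equals `s i` translated by the constant `h i i`, because `h i` is locally constant.
  refine ⟨fun x => op (h x x) • s x x, IsHorizontalSectionOn.of_eventuallyEq fun i =>
    ⟨fun x => op (h i i) • s i x, U i, hU i, hxU i, (hs i).act hP hA (hU i) _, ?_⟩⟩
  filter_upwards [hloc i i (hxU i), (hU i).mem_nhds (hxU i)] with x hx hxi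
  have h1 : x ∈ U i ∩ U x := ⟨hxi, hxU x⟩
  rw [← hx, ← hg i x x h1, op_mul, mul_smul, hP.act_translation (hpr i x x h1)]

end GlobalSection

/-! ### Equivalence of pairs -/

section Equivalence

variable {EM HM EG HG EP HP EP' HP' EP'' HP'' M G P P' P'' : Type*}
  [NormedAddCommGroup EM] [NormedSpace ℝ EM] [TopologicalSpace HM]
  [NormedAddCommGroup EG] [NormedSpace ℝ EG] [TopologicalSpace HG]
  [NormedAddCommGroup EP] [NormedSpace ℝ EP] [TopologicalSpace HP]
  [NormedAddCommGroup EP'] [NormedSpace ℝ EP'] [TopologicalSpace HP']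
  [NormedAddCommGroup EP''] [NormedSpace ℝ EP''] [TopologicalSpace HP'']
  {IG : ModelWithCorners ℝ EG HG} {IP : ModelWithCorners ℝ EP HP}
  {IP' : ModelWithCorners ℝ EP' HP'} {IP'' : ModelWithCorners ℝ EP'' HP''}
  [TopologicalSpace G] [ChartedSpace HG G] [Group G]
  [TopologicalSpace P] [ChartedSpace HP P] [MulAction Gᵐᵒᵖ P]
  [TopologicalSpace P'] [ChartedSpace HP' P'] [MulAction Gᵐᵒᵖ P']
  [TopologicalSpace P''] [ChartedSpace HP'' P''] [MulAction Gᵐᵒᵖ P'']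
  {π : P → M} {π' : P' → M} {π'' : P'' → M}

/-- The inverse of an isomorphism of principal bundles. -/
def PrincipalBundleIso.symm (f : PrincipalBundleIso G IP IP' π π') :
    PrincipalBundleIso G IP' IP π' π where
  toDiffeomorph := f.toDiffeomorph.symm
  proj_map q := by
    have := f.proj_map (f.toEquiv.symm q)
    rw [f.toEquiv.apply_symm_apply] at this
    exact this.symm
  map_act g q := f.toEquiv.injective (by
    have := f.map_act g (f.toEquiv.symm q)
    rw [f.toEquiv.apply_symm_apply] at this
    exact (f.toEquiv.apply_symm_apply _).trans this.symm)

/-- The composition of isomorphisms of principal bundles. -/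
def PrincipalBundleIso.trans (f : PrincipalBundleIso G IP IP' π π')
    (f' : PrincipalBundleIso G IP' IP'' π' π'') : PrincipalBundleIso G IP IP'' π π'' where
  toDiffeomorph := f.toDiffeomorph.trans f'.toDiffeomorph
  proj_map p := (f'.proj_map _).trans (f.proj_map p)
  map_act g p := (congrArg f'.toEquiv (f.map_act g p)).trans (f'.map_act g _)

omit [TopologicalSpace G] in
theorem PrincipalBundleIso.mdifferentiable (f : PrincipalBundleIso G IP IP' π π') :
    MDifferentiable IP IP' f.toEquiv :=
  f.contMDiff_toFun.mdifferentiable (by simp)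

variable {𝕜 : Type*} [RCLike 𝕜] {N : ℕ}
  {ρ : G →* (EuclideanSpace 𝕜 (Fin N) ≃ₗᵢ[𝕜] EuclideanSpace 𝕜 (Fin N))}
  {A : ∀ p : P, TangentSpace IP p →L[ℝ] GroupLieAlgebra IG G} {Φ : M → HiggsBundle P ρ}
  {A' : ∀ p : P', TangentSpace IP' p →L[ℝ] GroupLieAlgebra IG G} {Φ' : M → HiggsBundle P' ρ}
  {A'' : ∀ p : P'', TangentSpace IP'' p →L[ℝ] GroupLieAlgebra IG G}
  {Φ'' : M → HiggsBundle P'' ρ}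

theorem PairsEquivalent.symm (h : PairsEquivalent IG IP IP' π π' ρ A Φ A' Φ') :
    PairsEquivalent IG IP' IP π' π ρ A' Φ' A Φ := by
  obtain ⟨f, hA, hΦ⟩ := h
  refine ⟨f.symm, fun q w => ?_, fun x => ?_⟩
  · refine (hA (f.symm.toEquiv q) (mfderiv IP' IP f.symm.toEquiv q w)).symm.trans ?_
    -- `tangentMap` carries base point and vector together, which avoids transport between the
    -- tangent spaces at `f (f⁻¹ q)` and `q`.
    have h1 : tangentMap IP IP' f.toEquiv (tangentMap IP' IP f.symm.toEquiv ⟨q, w⟩) = ⟨q, w⟩ := by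
      rw [← tangentMap_comp_at _ (f.mdifferentiable _) (f.symm.mdifferentiable q)]
      have : f.toEquiv ∘ f.symm.toEquiv = id := funext f.toEquiv.apply_symm_apply
      rw [this, tangentMap_id]
      rfl
    exact congrArg (fun v : TangentBundle IP' P' => A' v.1 v.2) h1
  · rw [← hΦ x]
    generalize Φ x = e
    refine Quotient.inductionOn e fun a => ?_
    exact congrArg (Quotient.mk _) (Prod.ext (f.toEquiv.symm_apply_apply a.1) rfl)

theorem PairsEquivalent.trans (h : PairsEquivalent IG IP IP' π π' ρ A Φ A' Φ')
    (h' : PairsEquivalent IG IP' IP'' π' π'' ρ A' Φ' A'' Φ'') :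
    PairsEquivalent IG IP IP'' π π'' ρ A Φ A'' Φ'' := by
  obtain ⟨f, hA, hΦ⟩ := h
  obtain ⟨f', hA', hΦ'⟩ := h'
  refine ⟨f.trans f', fun p u => ?_, fun x => ?_⟩
  · refine Eq.trans ?_ ((hA' (f.toEquiv p) (mfderiv IP IP' f.toEquiv p u)).trans (hA p u))
    have h1 : tangentMap IP IP'' (f.trans f').toEquiv ⟨p, u⟩ =
        tangentMap IP' IP'' f'.toEquiv (tangentMap IP IP' f.toEquiv ⟨p, u⟩) :=
      tangentMap_comp_at _ (f'.mdifferentiable _) (f.mdifferentiable p)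
    exact congrArg (fun v : TangentBundle IP'' P'' => A'' v.1 v.2) h1
  · rw [← hΦ' x, ← hΦ x]
    generalize Φ x = e
    exact Quotient.inductionOn e fun a => rfl

end Equivalence

/-! ### Vacuum pairs and the canonical pair -/

section Vacuum

open Set Filter Topology

variable {EM HM EG HG EP HP M G P : Type*}
  [NormedAddCommGroup EM] [NormedSpace ℝ EM] [TopologicalSpace HM]
  [NormedAddCommGroup EG] [NormedSpace ℝ EG] [TopologicalSpace HG]
  [NormedAddCommGroup EP] [NormedSpace ℝ EP] [TopologicalSpace HP]
  {IM : ModelWithCorners ℝ EM HM} {IG : ModelWithCorners ℝ EG HG} {IP : ModelWithCorners ℝ EP HP}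
  [TopologicalSpace M] [ChartedSpace HM M]
  [TopologicalSpace G] [ChartedSpace HG G] [Group G] [LieGroup IG ∞ G]
  [TopologicalSpace P] [ChartedSpace HP P] [MulAction Gᵐᵒᵖ P] {π : P → M}
  {A : ∀ p : P, TangentSpace IP p →L[ℝ] GroupLieAlgebra IG G}
  {𝕜 : Type*} [RCLike 𝕜] {N : ℕ}
  {ρ : G →* (EuclideanSpace 𝕜 (Fin N) ≃ₗᵢ[𝕜] EuclideanSpace 𝕜 (Fin N))}
  {z₀ : EuclideanSpace 𝕜 (Fin N)} {Φ : M → HiggsBundle P ρ}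
  {φ : P → EuclideanSpace 𝕜 (Fin N)}

omit [LieGroup IG ∞ G] in
/-- The vacuum in terms of the equivariant map of the vacuum section. -/
theorem IsPrincipalBundle.mem_vacuumReduction_iff (hP : IsPrincipalBundle (G := G) IM IG IP π)
    (hφ : ∀ p : P, Φ (π p) = HiggsBundle.mk ρ p (φ p)) (p : P) :
    p ∈ vacuumReduction π ρ z₀ Φ ↔ φ p = z₀ := by
  change Φ (π p) = HiggsBundle.mk ρ p z₀ ↔ _
  rw [hφ p]
  refine ⟨fun h => ?_, fun h => by rw [h]⟩
  obtain ⟨g, hg⟩ := Quotient.exact h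
  -- Both representatives have first component `p`, so freeness of the action forces their second
  -- components to agree.
  have h1 : g = 1 := hP.act_injective p (by
    simpa using (congrArg Prod.fst hg).symm)
  have h2 : z₀ = ρ g⁻¹ (φ p) := congrArg Prod.snd hg
  rw [h2, h1]
  simp

omit [TopologicalSpace M] [TopologicalSpace G] [TopologicalSpace P] in
theorem exists_eq_of_mem_orbitBundle (hφ : ∀ p : P, Φ (π p) = HiggsBundle.mk ρ p (φ p))
    {p : P} (h : Φ (π p) ∈ orbitBundle P ρ z₀) : ∃ g : G, φ p = ρ g z₀ := by
  obtain ⟨q, g, hq⟩ := h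
  rw [hφ p] at hq
  obtain ⟨k, hk⟩ := Quotient.exact hq.symm
  refine ⟨k⁻¹ * g, ?_⟩
  rw [map_mul]
  exact congrArg Prod.snd hk

/-- The equivariant map of a vacuum section is constant in the horizontal directions of a
compatible connection. -/
theorem mfderiv_eq_zero_of_restrictsTo [IsManifold IP ∞ P]
    (hP : IsPrincipalBundle (G := G) IM IG IP π)
    (hA : IsConnection IG IP A) (hφs : ContMDiff IP 𝓘(ℝ, EuclideanSpace 𝕜 (Fin N)) ∞ φ)
    (hφe : ∀ (g : G) (p : P), φ (op g • p) = ρ g⁻¹ (φ p))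
    (hφ : ∀ p : P, Φ (π p) = HiggsBundle.mk ρ p (φ p))
    (hΦ : ∀ x, Φ x ∈ orbitBundle P ρ z₀) (hr : RestrictsTo IG IP A (vacuumReduction π ρ z₀ Φ))
    (p : P) (u : TangentSpace IP p) (hu : A p u = 0) :
    mfderiv IP 𝓘(ℝ, EuclideanSpace 𝕜 (Fin N)) φ p u = (0 : EuclideanSpace 𝕜 (Fin N)) := by
  have hφd : MDifferentiable IP 𝓘(ℝ, EuclideanSpace 𝕜 (Fin N)) φ :=
    hφs.mdifferentiable (by simp)
  obtain ⟨g, hg⟩ := exists_eq_of_mem_orbitBundle hφ (hΦ (π p))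
  -- Compatibility is a condition along the vacuum only, but every fibre meets the vacuum: translate
  -- `p` and `u` there.
  have hQ : op g • p ∈ vacuumReduction π ρ z₀ Φ := by
    rw [hP.mem_vacuumReduction_iff hφ, hφe, hg]
    change (ρ g⁻¹ * ρ g) z₀ = z₀
    rw [← map_mul]
    simp
  have hRd : MDifferentiable IP IP (fun q : P => op g • q) := fun q =>
    (hP.contMDiffAt_act (contMDiffAt_id (n := ∞)) contMDiffAt_const).mdifferentiableAt (by simp)
  have hu' : A (op g • p) (mfderiv IP IP (fun q : P => op g • q) p u) = 0 := by
    rw [hA.equivariant, hu, adjointAction_zero]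
  -- The translated vector is the velocity of a curve in the vacuum, on which `φ` is constantly
  -- `z₀`. Equivariance of `φ` and injectivity of `ρ g⁻¹` then bring the conclusion back to `p`.
  obtain ⟨γ, hγ, hγQ, hγ0⟩ := hr _ hQ _ hu'
  have hγd : MDifferentiableAt 𝓘(ℝ, ℝ) IP γ 0 := hγ.mdifferentiable (by simp) 0
  have h1 : mfderiv IP 𝓘(ℝ, EuclideanSpace 𝕜 (Fin N)) φ (γ 0)
      (mfderiv 𝓘(ℝ, ℝ) IP γ 0 (1 : ℝ)) = (0 : EuclideanSpace 𝕜 (Fin N)) := by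
    have h2 : φ ∘ γ = fun _ => z₀ := funext fun t =>
      (hP.mem_vacuumReduction_iff hφ _).1 (hγQ t)
    have h3 := mfderiv_comp 0 (hφd (γ 0)) hγd
    rw [h2, mfderiv_const] at h3
    exact (congrArg (fun L : ℝ →L[ℝ] EuclideanSpace 𝕜 (Fin N) => L 1) h3).symm
  have h2 : mfderiv IP 𝓘(ℝ, EuclideanSpace 𝕜 (Fin N)) φ (op g • p)
      (mfderiv IP IP (fun q : P => op g • q) p u) = (0 : EuclideanSpace 𝕜 (Fin N)) :=
    (congrArg (fun v : TangentBundle IP P =>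
      (mfderiv IP 𝓘(ℝ, EuclideanSpace 𝕜 (Fin N)) φ v.1 v.2 : EuclideanSpace 𝕜 (Fin N)))
      hγ0).symm.trans h1
  have h3 := mfderiv_comp p (hφd (op g • p)) (hRd p)
  let L : EuclideanSpace 𝕜 (Fin N) →L[ℝ] EuclideanSpace 𝕜 (Fin N) :=
    ((ρ g⁻¹).toContinuousLinearEquiv : EuclideanSpace 𝕜 (Fin N) →L[𝕜] EuclideanSpace 𝕜 (Fin N)
      ).restrictScalars ℝ
  have h4 : φ ∘ (fun q : P => op g • q) = L ∘ φ := funext fun q => hφe g q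
  have h5 : HasMFDerivAt IP 𝓘(ℝ, EuclideanSpace 𝕜 (Fin N)) (L ∘ φ) p
      (L.comp (mfderiv IP 𝓘(ℝ, EuclideanSpace 𝕜 (Fin N)) φ p)) :=
    HasMFDerivAt.comp p L.hasMFDerivAt (hφd p).hasMFDerivAt
  rw [h4, h5.mfderiv] at h3
  have h6 : (ρ g⁻¹) (mfderiv IP 𝓘(ℝ, EuclideanSpace 𝕜 (Fin N)) φ p u) =
      (0 : EuclideanSpace 𝕜 (Fin N)) :=
    (congrArg (fun L : EP →L[ℝ] EuclideanSpace 𝕜 (Fin N) => L u) h3).trans h2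
  exact (ρ g⁻¹).map_eq_zero_iff.1 h6

/-- The trivialization of a principal bundle given by a global section. -/
def IsPrincipalBundle.isoTrivialBundle (hP : IsPrincipalBundle (G := G) IM IG IP π) {s : M → P}
    (hs : ContMDiff IM IP ∞ s) (hsp : ∀ x, π (s x) = x) :
    PrincipalBundleIso G IP (IM.prod IG) π (TrivialBundle.proj (M := M) (G := G)) where
  toFun p := (π p, translation G (s (π p)) p)
  invFun a := op a.2 • s a.1
  left_inv p := hP.act_translation (hsp (π p))
  right_inv a := by
    have h1 : π (op a.2 • s a.1) = a.1 := (hP.proj_act _ _).trans (hsp _)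
    refine Prod.ext h1 ?_
    change translation G (s (π (op a.2 • s a.1))) (op a.2 • s a.1) = a.2
    rw [h1]
    exact hP.translation_eq rfl
  contMDiff_toFun := by
    refine ContMDiff.prodMk (M' := M) (N' := G) hP.contMDiff_proj fun p => ?_
    exact hP.contMDiffAt_translation (hs.comp hP.contMDiff_proj p) contMDiffAt_id
      (Eventually.of_forall fun q => hsp (π q))
  contMDiff_invFun := fun (a : M × G) =>
    hP.contMDiffAt_act (IN := IM.prod IG) (a := fun a : M × G => s a.1) (g := Prod.snd)
      (hs.comp contMDiff_fst a) contMDiffAt_snd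
  proj_map p := rfl
  map_act g p := by
    refine Prod.ext (hP.proj_act g p) ?_
    change translation G (s (π (op g • p))) (op g • p) = translation G (s (π p)) p * g
    rw [hP.proj_act]
    exact hP.translation_act (hsp (π p)) g

/-- Over a simply connected base, every vacuum pair is equivalent to the canonical pair. -/
theorem IsVacuumPair.equivalent_canonical [IsManifold IM ∞ M] [IsManifold IP ∞ P]
    [SimplyConnectedSpace M] [FiniteDimensional ℝ EM] [FiniteDimensional ℝ EG]
    [FiniteDimensional ℝ EP] [IM.Boundaryless] [IG.Boundaryless]
    (hP : IsPrincipalBundle (G := G) IM IG IP π) (h : IsVacuumPair IG IP π ρ z₀ A Φ) :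
    PairsEquivalent IG IP (IM.prod IG) π TrivialBundle.proj ρ A Φ
      (canonicalConnection M G IM IG) (canonicalSection M ρ z₀) := by
  have : IsManifold IM 1 M := IsManifold.of_le (n := ∞) (by simp)
  have hA := h.connection
  obtain ⟨φ, hφs, hφe, hφ⟩ := h.vacuumSection.1
  obtain ⟨s', hs'⟩ := exists_isHorizontalSectionOn_univ hP hA h.flat
  obtain ⟨x₀⟩ : Nonempty M := inferInstance
  obtain ⟨g, hg⟩ := exists_eq_of_mem_orbitBundle hφ (h.vacuumSection.2 (π (s' x₀)))
  -- The freedom of a constant translation is used to normalize the value of `φ` over one point.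
  obtain ⟨s, hs, hs0⟩ : ∃ s : M → P, IsHorizontalSectionOn IM π A s univ ∧ φ (s x₀) = z₀ := by
    refine ⟨_, hs'.act hP hA isOpen_univ g, ?_⟩
    rw [hφe, hg]
    change (ρ g⁻¹ * ρ g) z₀ = z₀
    rw [← map_mul]
    simp
  have hss : ContMDiff IM IP ∞ s := contMDiffOn_univ.1 hs.smooth
  have hsp : ∀ x, π (s x) = x := fun x => hs.proj x (mem_univ x)
  have hloc : IsLocallyConstant fun x => φ (s x) := by
    refine IsLocallyConstant.iff_eventually_eq _ |>.2 fun x => ?_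
    refine eventually_eq_of_mfderiv_eq_zero (IM := IM)
      (IN := 𝓘(ℝ, EuclideanSpace 𝕜 (Fin N))) (f := fun x => φ (s x))
      (Eventually.of_forall fun y => ?_)
    have h1 : MDifferentiableAt IP 𝓘(ℝ, EuclideanSpace 𝕜 (Fin N)) φ (s y) :=
      hφs.mdifferentiable (by simp) _
    have h2 : MDifferentiableAt IM IP s y := hss.mdifferentiable (by simp) y
    refine ⟨h1.comp y h2, ?_⟩
    ext1 u
    exact (congrArg (fun L : EM →L[ℝ] EuclideanSpace 𝕜 (Fin N) => L u)
      (mfderiv_comp y h1 h2)).trans (mfderiv_eq_zero_of_restrictsTo hP hA hφs hφe hφ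
        h.vacuumSection.2 h.compatible _ _ (hs.horizontal y (mem_univ y) u))
  have hconst : ∀ x, φ (s x) = z₀ := fun x =>
    (hloc.apply_eq_of_preconnectedSpace x x₀).trans hs0
  refine ⟨hP.isoTrivialBundle hss hsp, fun p u => ?_, fun x => ?_⟩
  · set τ : P → G := fun p => translation G (s (π p)) p with hτ
    have hπ : MDifferentiableAt IP IM π p := hP.contMDiff_proj.mdifferentiable (by simp) p
    have hτd : MDifferentiableAt IP IG τ p :=
      (hP.contMDiffAt_translation (hss.comp hP.contMDiff_proj p) contMDiffAt_id
        (Eventually.of_forall fun q => hsp (π q))).mdifferentiableAt (by simp)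
    have hsd : MDifferentiableAt IM IP s (π p) := hss.mdifferentiable (by simp) _
    -- Differentiating `p = s (π p) · τ p`: as `s` is horizontal, `A` is the Maurer-Cartan form
    -- pulled back by `τ`, that is, the canonical connection in the trivialization given by `s`.
    have h1 := hA.apply_mfderiv_act hP (hsd.comp p hπ) hτd u
    have h2 : (fun q => op (τ q) • (s ∘ π) q) = id := funext fun q => hP.act_translation (hsp _)
    have h3 : (A (op (τ p) • (s ∘ π) p)
        (mfderiv IP IP (fun q => op (τ q) • (s ∘ π) q) p u) : EG) = A p u := by
      have h4 : tangentMap IP IP (fun q => op (τ q) • (s ∘ π) q) ⟨p, u⟩ = ⟨p, u⟩ := by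
        rw [h2, tangentMap_id]; rfl
      exact congrArg (fun v : TangentBundle IP P => (A v.1 v.2 : EG)) h4
    have h4 : A ((s ∘ π) p) (mfderiv IP IP (s ∘ π) p u) = 0 :=
      (congrArg (fun L : EP →L[ℝ] EP => A (s (π p)) (L u)) (mfderiv_comp p hsd hπ)).trans
        (hs.horizontal (π p) (mem_univ _) _)
    rw [h4, adjointAction_zero, zero_add] at h1
    have h5 : mfderiv IP (IM.prod IG) (fun q : P => (π q, τ q)) p = _ := hπ.mfderiv_prod hτd
    exact (congrArg (fun L : EP →L[ℝ] EM × EG => (maurerCartan IG (τ p) (L u).2 : EG)) h5).trans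
      (h1.symm.trans h3)
  · have h1 := hφ (s x)
    rw [hsp, hconst] at h1
    rw [h1]
    have h2 : (hP.isoTrivialBundle hss hsp).toEquiv (s x) = ((x, 1) : M × G) := by
      refine Prod.ext (hsp x) ?_
      change translation G (s (π (s x))) (s x) = 1
      rw [hsp]
      exact hP.translation_eq (by simp)
    exact congrArg (fun a => HiggsBundle.mk ρ a z₀) h2

end Vacuum

end YangMillsHiggs

end

/-! ### Uniqueness of vacuum pairs over a simply connected base -/

theorem mainTheorem1
    {EM : Type*} [NormedAddCommGroup EM] [NormedSpace ℝ EM] [FiniteDimensional ℝ EM]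
    {HM : Type*} [TopologicalSpace HM] (IM : ModelWithCorners ℝ EM HM) [IM.Boundaryless]
    {EG : Type*} [NormedAddCommGroup EG] [NormedSpace ℝ EG] [FiniteDimensional ℝ EG]
    {HG : Type*} [TopologicalSpace HG] (IG : ModelWithCorners ℝ EG HG) [IG.Boundaryless]
    {EP : Type*} [NormedAddCommGroup EP] [NormedSpace ℝ EP] [FiniteDimensional ℝ EP]
    {HP : Type*} [TopologicalSpace HP] (IP : ModelWithCorners ℝ EP HP) [IP.Boundaryless]
    -- spacetime: a simply connected smooth manifold
    {M : Type*} [TopologicalSpace M] [ChartedSpace HM M] [IsManifold IM ∞ M]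
    [T2Space M] [ParacompactSpace M] [SimplyConnectedSpace M]
    -- the structure group: a compact Lie group
    {G : Type*} [TopologicalSpace G] [ChartedSpace HG G] [Group G] [LieGroup IG ∞ G]
    [T2Space G] [CompactSpace G]
    -- the principal bundle
    {P : Type*} [TopologicalSpace P] [ChartedSpace HP P] [IsManifold IP ∞ P] [MulAction Gᵐᵒᵖ P]
    (π : P → M) (hP : YangMillsHiggs.IsPrincipalBundle (G := G) IM IG IP π)
    -- the Higgs representation and the Higgs potential, with a chosen minimum
    {𝕜 : Type*} [RCLike 𝕜] {N : ℕ}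
    (ρ : G →* (EuclideanSpace 𝕜 (Fin N) ≃ₗᵢ[𝕜] EuclideanSpace 𝕜 (Fin N)))
    (hρ : YangMillsHiggs.IsHiggsRepresentation IG ρ)
    (V : EuclideanSpace 𝕜 (Fin N) → ℝ) (hV : YangMillsHiggs.IsGeneralHiggsPotential IG ρ V)
    (z₀ : EuclideanSpace 𝕜 (Fin N)) (hz₀ : YangMillsHiggs.IsMinimum V z₀) :
    -- any two vacuum pairs are gauge equivalent
    (∀ (A₁ A₂ : ∀ p : P, TangentSpace IP p →L[ℝ] GroupLieAlgebra IG G)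
        (Φ₁ Φ₂ : M → YangMillsHiggs.HiggsBundle P ρ),
      YangMillsHiggs.IsVacuumPair IG IP π ρ z₀ A₁ Φ₁ →
      YangMillsHiggs.IsVacuumPair IG IP π ρ z₀ A₂ Φ₂ →
      YangMillsHiggs.PairsEquivalent IG IP IP π π ρ A₁ Φ₁ A₂ Φ₂) ∧
    -- any vacuum pair is equivalent to the canonical pair on the trivial bundle
    (∀ (A : ∀ p : P, TangentSpace IP p →L[ℝ] GroupLieAlgebra IG G)
        (Φ : M → YangMillsHiggs.HiggsBundle P ρ),
      YangMillsHiggs.IsVacuumPair IG IP π ρ z₀ A Φ →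
      YangMillsHiggs.PairsEquivalent IG IP (IM.prod IG) π YangMillsHiggs.TrivialBundle.proj ρ A Φ
        (YangMillsHiggs.canonicalConnection M G IM IG)
        (YangMillsHiggs.canonicalSection M ρ z₀)) := by
  have key := fun (A : ∀ p : P, TangentSpace IP p →L[ℝ] GroupLieAlgebra IG G)
    (Φ : M → YangMillsHiggs.HiggsBundle P ρ)
    (h : YangMillsHiggs.IsVacuumPair IG IP π ρ z₀ A Φ) => h.equivalent_canonical hP
  -- The gauge transformation is the isomorphism of the first pair to the canonical pair followed by
  -- the inverse of that of the second.
  exact ⟨fun A₁ A₂ Φ₁ Φ₂ h₁ h₂ => (key A₁ Φ₁ h₁).trans (key A₂ Φ₂ h₂).symm, key⟩
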